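/- Definitions. Let $E$ be a finite ground set, $n=|E|$, and let $\mathcal M=(E,\mathcal I)$ be a matroid. The elements of $E$ arrive one by one in a uniformly random order. A (randomized) online algorithm knows $n$, and must irrevocably accept or reject each element upon its arrival. It has no other access to the instance than a value oracle, which returns $f(S)$, and an independence oracle, which tells whether $S\in\mathcal I$, both only for sets $S$ of elements that already arrived. In the matroid secretary problem (MSP) the objective is $f(S)=w(S)=\sum_{u\in S}w(u)$ for non-negative weights $w$; in the monotone submodular matroid secretary problem (MSMSP), $f\colon 2^E\to\mathbb R_{\ge 0}$ is a non-negative monotone submodular function. An algorithm for one of these problems must always accept an independent set. It is $c$-competitive on (or: has competitive ratio at most $c$ for) the matroid $\mathcal M$ if, for every objective $f$ of the problem on $\mathcal M$, the set $Q$ that it accepts satisfies $\mathbb E[f(Q)]\ge \frac1c\max_{S\in\mathcal I}f(S)$. Theorem. Let $\mathrm{Linear}$ be an arbitrary algorithm for MSP, and let $\alpha\ge 1$. 1. There exists an algorithm for MSMSP whose competitive ratio is at most $8\alpha(\alpha+1)$ for every matroid $\mathcal M$ on which $\mathrm{Linear}$ is $\alpha$-competitive. 2. There exists an algorithm for MSMSP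 such that, for every integer $k\ge 1$, its competitive ratio is at most $8k\alpha(\alpha+1)$ for every matroid $\mathcal M$ on which $\mathrm{Linear}$ behaves as follows: for every MSP instance over $\mathcal M$, with weight function $w$, there are $k$ (possibly correlated) random sets $P_1,\dots,P_k$ such that each $P_i$ is always independent in $\mathcal M$, $\mathbb E\big[w\big(\bigcup_{i=1}^kP_i\big)\big]\ge \frac1\alpha\max_{S\in\mathcal I}w(S)$, and the output of $\mathrm{Linear}$ is distributed as a uniformly random set among $P_1,\dots,P_k$. 3. For every $q\in(0,1]$ there exists an algorithm for MSMSP whose competitive ratio is at most $8\alpha(\alpha q+1)$ for every matroid $\mathcal M$ on which $\mathrm{Linear}$ is $\alpha$-competitive and, on every MSP instance over $\mathcal M$, selects every element with probability at most $q$. -/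

import Mathlib

universe u v

/-- What an online algorithm has seen at some point: the elements that already arrived, in the
order of their arrival, and the answers of the value oracle and of the independence oracle. -/
structure View (U : Type u) where
  arrived : List U
  value : Finset U → ℝ
  indep : Finset U → Prop

open Classical in
/-- The view after the elements of the list `l` arrived. The oracles answer queries about sets of
arrived elements only; every other query gets the same default answer. -/
noncomputable def observe {U : Type u} (M : Matroid U) (f : Finset U → ℝ) (l : List U) :
    View U where
  arrived := l
  value S := if S ⊆ l.toFinset then f S else 0
  indep S := S ⊆ l.toFinset ∧ M.Indep (S : Set U)

/-- A randomized online algorithm that selects elements of an unknown ground set (whose elements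
are taken from `U`). It is told the number `n` of elements and draws a random seed `ω`, whose
distribution may depend on `n`. When an element arrives, it accepts or rejects it, irrevocably, as
a function of `n`, the seed and the current view, the last entry of `arrived` being the new
element. (Earlier decisions are functions of the same data.) -/
structure OnlineAlgorithm (U : Type u) where
  Seed : ℕ → Type v
  seedSpace : ∀ n, MeasurableSpace (Seed n)
  law : ∀ n, MeasureTheory.Measure (Seed n)
  law_prob : ∀ n, MeasureTheory.IsProbabilityMeasure (law n)
  accepts : ∀ n, Seed n → View U → Prop
  measurable_accepts : ∀ n V, MeasurableSet {ω | accepts n ω V}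

attribute [instance] OnlineAlgorithm.seedSpace OnlineAlgorithm.law_prob

/-- `f` is linear on the subsets of `E`, with non-negative weights. -/
def IsLinearObjective {U : Type u} (E : Finset U) (f : Finset U → ℝ) : Prop :=
  ∃ w : U → ℝ, (∀ x ∈ E, 0 ≤ w x) ∧ ∀ S ⊆ E, f S = ∑ x ∈ S, w x

open Classical in
/-- `f` is non-negative, monotone and submodular on the subsets of `E`. -/
def IsMonotoneSubmodularObjective {U : Type u} (E : Finset U) (f : Finset U → ℝ) : Prop :=
  (∀ S ⊆ E, 0 ≤ f S) ∧
  (∀ S T, S ⊆ T → T ⊆ E → f S ≤ f T) ∧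
  (∀ A B, A ⊆ B → B ⊆ E → ∀ x ∈ E \ B, f (insert x B) - f B ≤ f (insert x A) - f A)

namespace OnlineAlgorithm

variable {U : Type u}

open Classical in
/-- The set of accepted elements when the elements of `E` arrive in the order `π` and the seed
is `ω`. -/
noncomputable def output (A : OnlineAlgorithm.{u, v} U) (E : Finset U) (M : Matroid U)
    (f : Finset U → ℝ) (π : Fin E.card ≃ E) (ω : A.Seed E.card) : Finset U :=
  (Finset.univ.filter fun i : Fin E.card =>
    A.accepts E.card ω
      (observe M f ((List.ofFn fun j => (π j : U)).take (i.val + 1)))).image fun i => (π i : U)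

open Classical in
/-- The expected objective value of the output, for a uniformly random arrival order and an
independent random seed. -/
noncomputable def expectedValue (A : OnlineAlgorithm.{u, v} U) (E : Finset U) (M : Matroid U)
    (f : Finset U → ℝ) : ℝ :=
  (∑ π : Fin E.card ≃ E, ∫ ω, f (A.output E M f π ω) ∂(A.law E.card)) /
    (Fintype.card (Fin E.card ≃ E) : ℝ)

open Classical in
/-- The probability that the output has the property `P`, for a uniformly random arrival order
and an independent random seed. -/
noncomputable def outputProb (A : OnlineAlgorithm.{u, v} U) (E : Finset U) (M : Matroid U)
    (f : Finset U → ℝ) (P : Finset U → Prop) : ℝ :=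
  (∑ π : Fin E.card ≃ E, (A.law E.card).real {ω | P (A.output E M f π ω)}) /
    (Fintype.card (Fin E.card ≃ E) : ℝ)

/-- On every instance over the matroid `M` (with ground set `E`) whose objective is in the class
`C`, the output is always independent. -/
def FeasibleOn (A : OnlineAlgorithm.{u, v} U) (C : Finset U → (Finset U → ℝ) → Prop)
    (E : Finset U) (M : Matroid U) : Prop :=
  ∀ f, C E f → ∀ π ω, M.Indep (A.output E M f π ω : Set U)

/-- The algorithm is `c`-competitive on the matroid `M` (with ground set `E`), for objectives in
the class `C`: its output is always independent, and its expected value is at least `1 / c` times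
the value of every independent set, in particular of an optimal one. -/
def CompetitiveOn (A : OnlineAlgorithm.{u, v} U) (C : Finset U → (Finset U → ℝ) → Prop)
    (E : Finset U) (M : Matroid U) (c : ℝ) : Prop :=
  A.FeasibleOn C E M ∧
  ∀ f, C E f → ∀ S : Finset U, M.Indep (S : Set U) → f S / c ≤ A.expectedValue E M f

/-- The algorithm always returns an independent set, whatever the (finite) matroid: it is an
algorithm for the secretary problem with objectives in the class `C`. -/
def IsAlgorithmFor (A : OnlineAlgorithm.{u, v} U) (C : Finset U → (Finset U → ℝ) → Prop) : Prop :=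
  ∀ (E : Finset U) (M : Matroid U), M.E = (E : Set U) → A.FeasibleOn C E M

open Classical in
/-- For every linear instance over `M` there are `k` correlated random independent sets
`P₁, …, P_k` (with joint law `μ`) such that the expected weight of their union is at least
`1 / α` times the weight of every independent set, and the output of the algorithm is distributed
as a uniformly random set among `P₁, …, P_k`. -/
def IsUniformAmong (A : OnlineAlgorithm.{u, v} U) (E : Finset U) (M : Matroid U)
    (k : ℕ) (α : ℝ) : Prop :=
  ∀ f, IsLinearObjective E f → ∃ μ : PMF (Fin k → E.powerset),
    (∀ P ∈ μ.support, ∀ i, M.Indep ((P i : Finset U) : Set U)) ∧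
    (∀ S : Finset U, M.Indep (S : Set U) →
      f S / α ≤ ∑ P : Fin k → E.powerset,
        (μ P).toReal * f (Finset.univ.biUnion fun i => (P i : Finset U))) ∧
    ∀ S : Finset U, A.outputProb E M f (fun Q => Q = S) =
      (∑ i : Fin k, ∑ P : Fin k → E.powerset,
        if (P i : Finset U) = S then (μ P).toReal else 0) / k

/-- On every linear instance over `M`, every element is selected with probability at most `q`. -/
def SelectsWithProbAtMost (A : OnlineAlgorithm.{u, v} U) (E : Finset U) (M : Matroid U)
    (q : ℝ) : Prop :=
  ∀ f, IsLinearObjective E f → ∀ x ∈ E, A.outputProb E M f (fun Q => x ∈ Q) ≤ q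

end OnlineAlgorithm

/-! Every element gets an independent label: 0 (sampled) with probability 1/2, 1 with probability
p/2, and 2 otherwise. Greedy by marginal value runs on the whole ground set but keeps only sampled
elements; the weight of an element is its marginal value at the moment greedy considers it.
Unsampled elements never change the greedy solution, so a weight depends only on the sample and the
element itself (`greedyWeight_insert_sample`) and is known online once the sample has arrived.
`Linear` is run with these weights on label 1 and weight 0 elsewhere, and its selected elements of
label 1 are accepted.

Let G be the expected growth of f on the sampled solution, J the expected weight of an independent
set chosen greedily among the elements of label 1, and D the expected total gap between the weights
of these elements and their marginals over the sampled solution together with the elements of label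
1 processed earlier. Potential arguments along the greedy run give f(O) ≤ f(∅) + 2G for independent
O (`le_expectedTotal_growth`), p G ≤ (1 + p) J (`le_expectedTotal_chosen`) and (1 + p) D ≤ p² G
(`expectedTotal_loss_le`). The value of a set of label 1 is at least f(∅) plus its weight minus the
losses of its elements (`exists_loss`). If every element is selected with probability at most q, the
expected value is therefore at least f(∅) + J/α - q D, and p = 1/(2(αq + 1)) turns this into
f(O)/(8α(αq + 1)). The first claim is the case q = 1. For the second, the bound with q = 1 is
applied to the union of the k sets, and subadditivity of f costs a factor k.

Online, labels belong to the positions of a simulated order, rearranged in real time so that sampled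
positions come first. For each labelling this rearrangement is a bijection of arrival orders, so
element labels and simulated order are independent (`expectedValue_guarded_reduction`). A guard that
rejects dependent sets makes the algorithm feasible on every matroid. -/

/-! ### Greedy weights and their dependence on the sample alone. -/

section GreedyProcess

open Classical

variable {U : Type u}

/-- The marginal value of `x` with respect to `S`. -/
noncomputable def marginal (f : Finset U → ℝ) (S : Finset U) (x : U) : ℝ := f (insert x S) - f S

/-- The elements of `R` that can be added to `S`. -/
noncomputable def available (ind : Finset U → Prop) (S R : Finset U) : Finset U :=
  R.filter fun x => ind (insert x S)

theorem exists_marginal_max (f : Finset U → ℝ) (S : Finset U) {C : Finset U} (h : C.Nonempty) :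
    {x | x ∈ C ∧ ∀ y ∈ C, marginal f S y ≤ marginal f S x}.Nonempty := by
  obtain ⟨x, hx, hmax⟩ := C.exists_max_image (marginal f S) h
  exact ⟨x, hx, hmax⟩

/-- The element of `C` of maximum marginal value, ties being broken by a fixed well-order. -/
noncomputable def greedyPick (f : Finset U → ℝ) (S C : Finset U) (h : C.Nonempty) : U :=
  WellOrderingRel.isWellOrder.toIsWellFounded.wf.min
    {x | x ∈ C ∧ ∀ y ∈ C, marginal f S y ≤ marginal f S x} (exists_marginal_max f S h)

theorem greedyPick_spec (f : Finset U → ℝ) (S C : Finset U) (h : C.Nonempty) :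
    greedyPick f S C h ∈ C ∧
      ∀ y ∈ C, marginal f S y ≤ marginal f S (greedyPick f S C h) :=
  WellOrderingRel.isWellOrder.toIsWellFounded.wf.min_mem
    {x | x ∈ C ∧ ∀ y ∈ C, marginal f S y ≤ marginal f S x} (exists_marginal_max f S h)

theorem greedyPick_mem_available {ind : Finset U → Prop} {f : Finset U → ℝ} {S R : Finset U}
    (h : (available ind S R).Nonempty) :
    greedyPick f S (available ind S R) h ∈ R ∧
      ind (insert (greedyPick f S (available ind S R) h) S) := by
  simpa [available] using (greedyPick_spec f S _ h).1

/-- Ties are broken by a well-order that does not depend on the candidate set, so deleting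
candidates other than the pick leaves the pick unchanged. This makes unsampled elements harmless. -/
theorem greedyPick_of_subset (f : Finset U → ℝ) (S : Finset U) {C D : Finset U} (hDC : D ⊆ C)
    (hC : C.Nonempty) (hmem : greedyPick f S C hC ∈ D) :
    greedyPick f S D ⟨_, hmem⟩ = greedyPick f S C hC := by
  have hset : {x | x ∈ D ∧ ∀ y ∈ D, marginal f S y ≤ marginal f S x} ⊆
      {x | x ∈ C ∧ ∀ y ∈ C, marginal f S y ≤ marginal f S x} := fun x hx =>
    ⟨hDC hx.1, fun y hy => ((greedyPick_spec f S C hC).2 y hy).trans (hx.2 _ hmem)⟩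
  have h1 := WellOrderingRel.isWellOrder.toIsWellFounded.wf.not_lt_min
    {x | x ∈ C ∧ ∀ y ∈ C, marginal f S y ≤ marginal f S x}
    (hset (greedyPick_spec f S D ⟨_, hmem⟩))
  have h2 := WellOrderingRel.isWellOrder.toIsWellFounded.wf.not_lt_min
    {x | x ∈ D ∧ ∀ y ∈ D, marginal f S y ≤ marginal f S x}
    (x := greedyPick f S C hC) ⟨hmem, fun y hy => (greedyPick_spec f S C hC).2 y (hDC hy)⟩
  have htri := (inferInstance : Std.Trichotomous (WellOrderingRel (α := U)))
  exact htri.trichotomous _ _ h1 h2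

theorem greedyPick_congr {f f' : Finset U → ℝ} {S C : Finset U} (h : C.Nonempty)
    (hf : f S = f' S) (hf' : ∀ x ∈ C, f (insert x S) = f' (insert x S)) :
    greedyPick f S C h = greedyPick f' S C h := by
  have hset : {x | x ∈ C ∧ ∀ y ∈ C, marginal f S y ≤ marginal f S x} =
      {x | x ∈ C ∧ ∀ y ∈ C, marginal f' S y ≤ marginal f' S x} := by
    ext x
    refine and_congr_right fun hx => forall₂_congr fun y hy => ?_
    simp only [marginal, hf, hf' x hx, hf' y hy]
  simp only [greedyPick, hset]

variable (ind : Finset U → Prop) (f : Finset U → ℝ)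

/-- The greedy algorithm processes the elements of `R` that can be added to `S` in the order of
their marginal values, and adds those of label `0`. The weight of an element is its marginal value
when it is processed, or `0` if it never is. -/
noncomputable def greedyWeight (t : U → Fin 3) (S R : Finset U) : U → ℝ :=
  if h : (available ind S R).Nonempty then
    Function.update
      (greedyWeight t
        (if t (greedyPick f S (available ind S R) h) = 0 then
          insert (greedyPick f S (available ind S R) h) S else S)
        (R.erase (greedyPick f S (available ind S R) h)))
      (greedyPick f S (available ind S R) h) (marginal f S (greedyPick f S (available ind S R) h))
  else 0
termination_by R.card
decreasing_by exact Finset.card_erase_lt_of_mem (greedyPick_mem_available h).1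

theorem greedyWeight_of_nonempty (t : U → Fin 3) {S R : Finset U}
    (h : (available ind S R).Nonempty) {x : U}
    (hx : greedyPick f S (available ind S R) h = x) :
    greedyWeight ind f t S R = Function.update
      (greedyWeight ind f t (if t x = 0 then insert x S else S) (R.erase x)) x
      (marginal f S x) := by
  rw [greedyWeight, dif_pos h, hx]

theorem greedyWeight_of_not_nonempty (t : U → Fin 3) {S R : Finset U}
    (h : ¬ (available ind S R).Nonempty) : greedyWeight ind f t S R = 0 := by
  rw [greedyWeight, dif_neg h]

variable {ind f}

theorem greedyWeight_nonneg (hmono : Monotone f) (t : U → Fin 3) (S R : Finset U) (y : U) :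
    0 ≤ greedyWeight ind f t S R y := by
  induction R using Finset.strongInduction generalizing S with
  | H R ih =>
    by_cases h : (available ind S R).Nonempty
    · have hx := (greedyPick_mem_available (f := f) h).1
      rw [greedyWeight_of_nonempty ind f t h rfl]
      rcases eq_or_ne y (greedyPick f S (available ind S R) h) with hy | hy
      · rw [hy, Function.update_self]
        exact sub_nonneg.2 (hmono (Finset.subset_insert _ _))
      · rw [Function.update_of_ne hy]
        exact ih _ (Finset.erase_ssubset hx) _
    · rw [greedyWeight_of_not_nonempty ind f t h]; rfl

/-- The greedy process depends only on the oracle answers about subsets of `S ∪ R`. -/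
theorem greedyWeight_congr {ind' : Finset U → Prop} {f' : Finset U → ℝ} {t t' : U → Fin 3}
    {S R : Finset U} (hind : ∀ T ⊆ S ∪ R, (ind T ↔ ind' T)) (hf : ∀ T ⊆ S ∪ R, f T = f' T)
    (ht : ∀ x ∈ R, t x = t' x) :
    greedyWeight ind f t S R = greedyWeight ind' f' t' S R := by
  induction R using Finset.strongInduction generalizing S with
  | H R ih =>
    have hav : available ind S R = available ind' S R := by
      refine Finset.filter_congr fun x hx => hind _ ?_
      grind
    by_cases h : (available ind S R).Nonempty
    · have h' : (available ind' S R).Nonempty := hav ▸ h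
      have hxR := (greedyPick_mem_available (f := f) h).1
      have hpick : greedyPick f' S (available ind' S R) h' =
          greedyPick f S (available ind S R) h := by
        rw [greedyPick_congr h (f' := f') (hf _ Finset.subset_union_left)]
        · congr 1
          exact hav.symm
        · intro x hx
          refine hf _ ?_
          have : x ∈ R := (Finset.mem_filter.1 hx).1
          grind
      rw [greedyWeight_of_nonempty ind f t h rfl, greedyWeight_of_nonempty ind' f' t' h' hpick,
        ← ht _ hxR]
      set x := greedyPick f S (available ind S R) h
      have hsub : (if t x = 0 then insert x S else S) ∪ R.erase x ⊆ S ∪ R := by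
        split_ifs <;> grind
      rw [ih _ (Finset.erase_ssubset hxR) (fun T hT => hind T (hT.trans hsub))
        (fun T hT => hf T (hT.trans hsub)) (fun y hy => ht y (Finset.mem_of_mem_erase hy))]
      rw [marginal, marginal, hf _ Finset.subset_union_left, hf (insert x S) (by grind)]
    · rw [greedyWeight_of_not_nonempty ind f t h,
        greedyWeight_of_not_nonempty ind' f' t' (hav ▸ h)]

theorem available_erase (S R : Finset U) (y : U) :
    available ind S (R.erase y) = (available ind S R).erase y := by
  ext; simp [available]; tauto

/-- Elements that are not sampled do not influence the weights of other elements. -/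
theorem greedyWeight_erase (t : U → Fin 3) {S R : Finset U} {x y : U} (hy : t y ≠ 0)
    (hxy : x ≠ y) : greedyWeight ind f t S (R.erase y) x = greedyWeight ind f t S R x := by
  induction R using Finset.strongInduction generalizing S with
  | H R ih =>
    by_cases h : (available ind S R).Nonempty
    · have hzR := (greedyPick_mem_available (f := f) h).1
      have hzA := (greedyPick_spec f S _ h).1
      rw [greedyWeight_of_nonempty ind f t h rfl]
      set z := greedyPick f S (available ind S R) h with hz
      -- If greedy picks `y`, it discards it, which is the run on `R.erase y`; otherwise deleting
      -- `y` does not affect the pick.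
      by_cases hzy : z = y
      · rw [hzy, if_neg hy, Function.update_of_ne hxy]
      · have hmem : z ∈ available ind S (R.erase y) := by
          rw [available_erase]; exact Finset.mem_erase.2 ⟨hzy, hzA⟩
        have hpick := greedyPick_of_subset f S
          (D := available ind S (R.erase y)) (by rw [available_erase]; exact Finset.erase_subset _ _)
          h hmem
        rw [greedyWeight_of_nonempty ind f t ⟨_, hmem⟩ hpick]
        rcases eq_or_ne x z with hxz | hxz
        · rw [← hz, ← hxz, Function.update_self, Function.update_self]
        · rw [← hz, Function.update_of_ne hxz, Function.update_of_ne hxz, Finset.erase_right_comm]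
          exact ih _ (Finset.erase_ssubset hzR)
    · have h' : ¬ (available ind S (R.erase y)).Nonempty := by
        rw [Finset.not_nonempty_iff_eq_empty] at h ⊢
        rw [available_erase, h, Finset.erase_empty]
      rw [greedyWeight_of_not_nonempty ind f t h, greedyWeight_of_not_nonempty ind f t h']

/-- The weight of `x` is determined by the sampled elements and `x` itself. -/
theorem greedyWeight_insert_sample (t : U → Fin 3) (S : Finset U) {R : Finset U} {x : U}
    (hx : x ∈ R) :
    greedyWeight ind f t S (insert x (R.filter fun y => t y = 0)) x =
      greedyWeight ind f t S R x := by
  have key : ∀ D ⊆ R, (∀ y ∈ D, t y ≠ 0 ∧ x ≠ y) →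
      greedyWeight ind f t S (R \ D) x = greedyWeight ind f t S R x := by
    intro D
    induction D using Finset.induction_on with
    | empty => simp
    | insert y D hyD ih =>
      intro hD hy
      rw [Finset.sdiff_insert, greedyWeight_erase t (hy y (by simp)).1 (hy y (by simp)).2]
      exact ih (by grind) (by grind)
  rw [← key (R.filter fun y => t y ≠ 0 ∧ x ≠ y) (Finset.filter_subset _ _) (by simp)]
  congr 1
  ext y
  simp only [Finset.mem_insert, Finset.mem_filter, Finset.mem_sdiff]
  grind

end GreedyProcess

/-! ### Rewards collected along one greedy run. -/

section GreedyTotals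

open Classical

variable {U : Type u}

/-- The state of the greedy process: the sampled elements of the greedy solution, the processed
elements of label `1`, and a greedily chosen independent subset of the latter. -/
structure GreedyState (U : Type u) where
  sample : Finset U
  marked : Finset U
  chosen : Finset U

variable (ind : Finset U → Prop) (f : Finset U → ℝ)

/-- The state after an element `x` of label `a` is processed. -/
noncomputable def GreedyState.next (S : GreedyState U) (x : U) (a : Fin 3) : GreedyState U where
  sample := if a = 0 then insert x S.sample else S.sample
  marked := if a = 1 then insert x S.marked else S.marked
  chosen := if a = 1 ∧ ind (insert x S.chosen) then insert x S.chosen else S.chosen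

/-- The sum of the rewards `r` that the greedy process collects. -/
noncomputable def greedyTotal (r : GreedyState U → U → Fin 3 → ℝ) (t : U → Fin 3)
    (S : GreedyState U) (R : Finset U) : ℝ :=
  if h : (available ind S.sample R).Nonempty then
    r S (greedyPick f S.sample (available ind S.sample R) h)
      (t (greedyPick f S.sample (available ind S.sample R) h)) +
    greedyTotal r t
      (S.next ind (greedyPick f S.sample (available ind S.sample R) h)
        (t (greedyPick f S.sample (available ind S.sample R) h)))
      (R.erase (greedyPick f S.sample (available ind S.sample R) h))
  else 0
termination_by R.card
decreasing_by exact Finset.card_erase_lt_of_mem (greedyPick_mem_available h).1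

theorem greedyTotal_of_nonempty (r : GreedyState U → U → Fin 3 → ℝ) (t : U → Fin 3)
    {S : GreedyState U} {R : Finset U} (h : (available ind S.sample R).Nonempty) {x : U}
    (hx : greedyPick f S.sample (available ind S.sample R) h = x) :
    greedyTotal ind f r t S R =
      r S x (t x) + greedyTotal ind f r t (S.next ind x (t x)) (R.erase x) := by
  rw [greedyTotal, dif_pos h, hx]

theorem greedyTotal_of_not_nonempty (r : GreedyState U → U → Fin 3 → ℝ) (t : U → Fin 3)
    {S : GreedyState U} {R : Finset U} (h : ¬ (available ind S.sample R).Nonempty) :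
    greedyTotal ind f r t S R = 0 := by
  rw [greedyTotal, dif_neg h]

/-- The increase of the value of the sampled part of the greedy solution. -/
noncomputable def growthReward (S : GreedyState U) (x : U) (a : Fin 3) : ℝ :=
  if a = 0 then marginal f S.sample x else 0

/-- The increase of the weight of the chosen elements. -/
noncomputable def chosenReward (S : GreedyState U) (x : U) (a : Fin 3) : ℝ :=
  if a = 1 ∧ ind (insert x S.chosen) then marginal f S.sample x else 0

/-- The decrease of the marginal value of a marked element caused by earlier marked elements. -/
noncomputable def lossReward (S : GreedyState U) (x : U) (a : Fin 3) : ℝ :=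
  if a = 1 then marginal f S.sample x - marginal f (S.sample ∪ S.marked) x else 0

variable {ind f}

theorem GreedyState.subset_next (S : GreedyState U) (x : U) (a : Fin 3) :
    S.sample ∪ S.marked ⊆ (S.next ind x a).sample ∪ (S.next ind x a).marked := by
  simp only [GreedyState.next]
  split_ifs <;> grind

/-- A label is read only when its element is processed. Hence the label of a processed element is
independent of the rest of the run. -/
theorem greedyTotal_update (r : GreedyState U → U → Fin 3 → ℝ) (t : U → Fin 3)
    (S : GreedyState U) {R : Finset U} {y : U} (hy : y ∉ R) (a : Fin 3) :
    greedyTotal ind f r (Function.update t y a) S R = greedyTotal ind f r t S R := by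
  induction R using Finset.strongInduction generalizing S with
  | H R ih =>
    by_cases h : (available ind S.sample R).Nonempty
    · have hx := (greedyPick_mem_available (f := f) h).1
      rw [greedyTotal_of_nonempty ind f r _ h rfl, greedyTotal_of_nonempty ind f r _ h rfl,
        Function.update_of_ne (by grind), ih _ (Finset.erase_ssubset hx) _ (by grind)]
    · rw [greedyTotal_of_not_nonempty ind f r _ h, greedyTotal_of_not_nonempty ind f r _ h]

/-- The process builds `I` itself, taking a processed element of label 1 whenever independence
allows it. This set is the benchmark against which the linear algorithm is measured. -/
theorem exists_chosen (t : U → Fin 3)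
    (S : GreedyState U) (R : Finset U) (hS : ind S.chosen) :
    ∃ I ⊆ R, (∀ x ∈ I, t x = 1) ∧ ind (S.chosen ∪ I) ∧
      greedyTotal ind f (chosenReward ind f) t S R =
        ∑ x ∈ I, greedyWeight ind f t S.sample R x := by
  induction R using Finset.strongInduction generalizing S with
  | H R ih =>
    by_cases h : (available ind S.sample R).Nonempty
    · have hx := (greedyPick_mem_available (f := f) h).1
      rw [greedyTotal_of_nonempty ind f _ t h rfl, greedyWeight_of_nonempty ind f t h rfl]
      set x := greedyPick f S.sample (available ind S.sample R) h
      have hS' : ind (S.next ind x (t x)).chosen := by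
        simp only [GreedyState.next]; split_ifs with h1
        exacts [h1.2, hS]
      obtain ⟨I, hIR, hI1, hI, hsum⟩ := ih _ (Finset.erase_ssubset hx) _ hS'
      have hxI : x ∉ I := fun hxI => (Finset.mem_erase.1 (hIR hxI)).1 rfl
      have hrest : ∑ y ∈ I, greedyWeight ind f t (S.next ind x (t x)).sample (R.erase x) y =
          ∑ y ∈ I, Function.update (greedyWeight ind f t
            (if t x = 0 then insert x S.sample else S.sample) (R.erase x)) x
              (marginal f S.sample x) y := by
        refine Finset.sum_congr rfl fun y hy => ?_
        rw [Function.update_of_ne (by rintro rfl; exact hxI hy)]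
        rfl
      by_cases h1 : t x = 1 ∧ ind (insert x S.chosen)
      · refine ⟨insert x I, Finset.insert_subset hx (hIR.trans (Finset.erase_subset _ _)),
          Finset.forall_mem_insert _ _ _ |>.2 ⟨h1.1, hI1⟩, ?_, ?_⟩
        · simpa [GreedyState.next, h1] using hI
        · rw [hsum, Finset.sum_insert hxI, hrest, Function.update_self, chosenReward, if_pos h1]
      · refine ⟨I, hIR.trans (Finset.erase_subset _ _), hI1, ?_, ?_⟩
        · simpa only [GreedyState.next, if_neg h1] using hI
        · rw [hsum, hrest, chosenReward, if_neg h1, zero_add]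
    · refine ⟨∅, by simp, by simp, by simpa using hS, ?_⟩
      rw [greedyTotal_of_not_nonempty ind f _ t h, Finset.sum_empty]

/-- The value of a set of elements of label `1` is at least its weight, up to a loss. -/
theorem exists_loss (hmono : Monotone f)
    (hsub : ∀ A B, A ⊆ B → ∀ x, marginal f B x ≤ marginal f A x) (t : U → Fin 3)
    (S : GreedyState U) (R : Finset U) :
    ∃ δ : U → ℝ, (∀ x, 0 ≤ δ x) ∧
      ∑ x ∈ R, δ x = greedyTotal ind f (lossReward f) t S R ∧
      ∀ Y ⊆ S.sample ∪ S.marked, ∀ X ⊆ R, (∀ x ∈ X, t x = 1) →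
        f Y + ∑ x ∈ X, (greedyWeight ind f t S.sample R x - δ x) ≤ f (Y ∪ X) := by
  induction R using Finset.strongInduction generalizing S with
  | H R ih =>
    by_cases h : (available ind S.sample R).Nonempty
    · have hx := (greedyPick_mem_available (f := f) h).1
      rw [greedyTotal_of_nonempty ind f _ t h rfl, greedyWeight_of_nonempty ind f t h rfl]
      set x := greedyPick f S.sample (available ind S.sample R) h
      obtain ⟨δ, hδ, hsum, hval⟩ := ih _ (Finset.erase_ssubset hx) (S.next ind x (t x))
      have hne : ∀ T ⊆ R.erase x, ∀ y ∈ T, y ≠ x := fun T hT y hy => by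
        rintro rfl; exact (Finset.mem_erase.1 (hT hy)).1 rfl
      refine ⟨Function.update δ x (lossReward f S x (t x)), ?_, ?_, ?_⟩
      · intro y
        rcases eq_or_ne y x with rfl | hy
        · rw [Function.update_self, lossReward]
          split_ifs
          · exact sub_nonneg.2 (hsub _ _ Finset.subset_union_left _)
          · exact le_rfl
        · rw [Function.update_of_ne hy]; exact hδ y
      · rw [← Finset.add_sum_erase _ _ hx, Function.update_self, ← hsum]
        congr 1
        exact Finset.sum_congr rfl fun y hy =>
          Function.update_of_ne (hne _ subset_rfl y hy) _ _
      · intro Y hY X hX hX1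
        have hrest : ∀ T ⊆ R.erase x,
            ∑ y ∈ T, (greedyWeight ind f t (S.next ind x (t x)).sample (R.erase x) y - δ y) =
            ∑ y ∈ T, (Function.update (greedyWeight ind f t
              (if t x = 0 then insert x S.sample else S.sample) (R.erase x)) x
                (marginal f S.sample x) y - Function.update δ x (lossReward f S x (t x)) y) := by
          intro T hT
          refine Finset.sum_congr rfl fun y hy => ?_
          rw [Function.update_of_ne (hne T hT y hy), Function.update_of_ne (hne T hT y hy)]
          rfl
        have hsubset : S.sample ∪ S.marked ⊆
            (S.next ind x (t x)).sample ∪ (S.next ind x (t x)).marked :=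
          S.subset_next x (t x)
        by_cases hxX : x ∈ X
        · have hsubX : X.erase x ⊆ R.erase x := Finset.erase_subset_erase _ hX
          have h1 := hX1 x hxX
          -- Having label 1, `x` becomes marked, so the induction hypothesis applies to `insert x
          -- Y`. The marginal of `x` over `Y` is at least its marginal over sample and marked
          -- elements, which is weight minus loss.
          have := hval (insert x Y) (by
            refine Finset.insert_subset ?_ (hY.trans hsubset)
            simp [GreedyState.next, h1]) (X.erase x) hsubX
            (fun y hy => hX1 y (Finset.mem_of_mem_erase hy))
          rw [← Finset.add_sum_erase _ _ hxX, ← hrest _ hsubX, Function.update_self,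
            Function.update_self, lossReward, if_pos h1]
          have hu : insert x Y ∪ X.erase x = Y ∪ X := by
            rw [Finset.insert_union, ← Finset.union_insert, Finset.insert_erase hxX]
          rw [hu] at this
          have hm := hsub _ _ hY x
          simp only [marginal] at hm ⊢
          linarith
        · have hsubX : X ⊆ R.erase x := Finset.subset_erase.2 ⟨hX, hxX⟩
          rw [← hrest _ hsubX]
          exact hval Y (hY.trans hsubset) X hsubX hX1
    · refine ⟨0, by simp, ?_, fun Y _ X _ _ => ?_⟩
      · rw [greedyTotal_of_not_nonempty ind f _ t h]; simp
      · rw [greedyWeight_of_not_nonempty ind f t h]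
        simpa using hmono Finset.subset_union_left

end GreedyTotals

/-! ### Expectations over independent labels. -/

section LabelExpectation

/-- The distribution of the label of an element. -/
noncomputable def labelProb (p : ℝ) : Fin 3 → ℝ := ![1 / 2, p / 2, (1 - p) / 2]

theorem sum_labelProb (p : ℝ) : ∑ a, labelProb p a = 1 := by
  simp [labelProb, Fin.sum_univ_three]; ring

theorem labelProb_nonneg {p : ℝ} (h0 : 0 ≤ p) (h1 : p ≤ 1) (a : Fin 3) : 0 ≤ labelProb p a := by
  fin_cases a <;> simp [labelProb] <;> linarith

/-- The expectation of `G` for independent labels. -/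
noncomputable def labelExp {ι : Type*} [Fintype ι] [DecidableEq ι] (p : ℝ)
    (G : (ι → Fin 3) → ℝ) : ℝ :=
  ∑ e, (∏ x, labelProb p (e x)) * G e

variable {ι : Type*} [Fintype ι] [DecidableEq ι] {p : ℝ}

theorem labelExp_add (G H : (ι → Fin 3) → ℝ) :
    labelExp p (fun e => G e + H e) = labelExp p G + labelExp p H := by
  simp only [labelExp, mul_add, Finset.sum_add_distrib]

theorem labelExp_sub (G H : (ι → Fin 3) → ℝ) :
    labelExp p (fun e => G e - H e) = labelExp p G - labelExp p H := by
  simp only [labelExp, mul_sub, Finset.sum_sub_distrib]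

theorem labelExp_const_mul (c : ℝ) (G : (ι → Fin 3) → ℝ) :
    labelExp p (fun e => c * G e) = c * labelExp p G := by
  simp only [labelExp, Finset.mul_sum, mul_left_comm]

theorem labelExp_const (c : ℝ) : labelExp (ι := ι) p (fun _ => c) = c := by
  rw [labelExp, ← Finset.sum_mul, ← Fintype.prod_sum (fun (_ : ι) a => labelProb p a)]
  simp [sum_labelProb]

theorem labelExp_mono (h0 : 0 ≤ p) (h1 : p ≤ 1) {G H : (ι → Fin 3) → ℝ} (h : ∀ e, G e ≤ H e) :
    labelExp p G ≤ labelExp p H :=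
  Finset.sum_le_sum fun e _ => mul_le_mul_of_nonneg_left (h e)
    (Finset.prod_nonneg fun _ _ => labelProb_nonneg h0 h1 _)

/-- The law of total expectation for the label of `x`. -/
theorem labelExp_eq_sum_update (G : (ι → Fin 3) → ℝ) (x : ι) :
    labelExp p G =
      ∑ a, labelProb p a * labelExp p (fun e => G (Function.update e x a)) := by
  have hswap : ∑ q : Fin 3 × (ι → Fin 3),
        labelProb p q.1 * ((∏ y, labelProb p (q.2 y)) * G (Function.update q.2 x q.1)) =
      ∑ q : Fin 3 × (ι → Fin 3), labelProb p q.1 * ((∏ y, labelProb p (q.2 y)) * G q.2) := by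
    -- Exchanging the extra label with the label of `x` is an involution that preserves the product
    -- weights.
    refine Finset.sum_nbij' (fun q => (q.2 x, Function.update q.2 x q.1))
      (fun q => (q.2 x, Function.update q.2 x q.1)) (by simp) (by simp) (by simp) (by simp) ?_
    rintro ⟨a, e⟩ -
    simp only
    rw [← Finset.mul_prod_erase _ _ (Finset.mem_univ x),
      ← Finset.mul_prod_erase _ (fun y => labelProb p (Function.update e x a y))
        (Finset.mem_univ x), Function.update_self]
    have : ∏ y ∈ Finset.univ.erase x, labelProb p (Function.update e x a y) =
        ∏ y ∈ Finset.univ.erase x, labelProb p (e y) :=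
      Finset.prod_congr rfl fun y hy => by rw [Function.update_of_ne (Finset.ne_of_mem_erase hy)]
    rw [this]; ring
  rw [Fintype.sum_prod_type, Fintype.sum_prod_type] at hswap
  simp only [← Finset.mul_sum] at hswap
  simp only [labelExp]
  rw [hswap, ← Finset.sum_mul, sum_labelProb, one_mul]

theorem labelExp_comp_equiv {κ : Type*} [Fintype κ] [DecidableEq κ] (σ : ι ≃ κ)
    (G : (κ → Fin 3) → ℝ) :
    labelExp p (fun e : ι → Fin 3 => G (e ∘ σ.symm)) = labelExp p G := by
  refine Fintype.sum_equiv (Equiv.arrowCongr σ (Equiv.refl _)) _ _ fun e => ?_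
  congr 1
  exact Fintype.prod_equiv σ _ _ fun i => by simp

end LabelExpectation

/-! ### The three potential arguments for the greedy process. -/

section GreedyExpectation

open Classical

variable {U : Type u}

/-- The labelling of all elements that agrees with `e` on `E`. -/
noncomputable def extendLabel (E : Finset U) (e : E → Fin 3) (x : U) : Fin 3 :=
  if h : x ∈ E then e ⟨x, h⟩ else 2

theorem extendLabel_update (E : Finset U) (e : E → Fin 3) {x : U} (hx : x ∈ E) (a : Fin 3) :
    extendLabel E (Function.update e ⟨x, hx⟩ a) = Function.update (extendLabel E e) x a := by
  funext y
  rcases eq_or_ne y x with rfl | hy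
  · simp [extendLabel, hx]
  · rw [Function.update_of_ne hy]
    unfold extendLabel
    split_ifs
    · rw [Function.update_of_ne (by simpa using hy)]
    · rfl

/-- The expected total reward for random labels of the elements of `E`. -/
noncomputable def expectedTotal (ind : Finset U → Prop) (f : Finset U → ℝ) (E : Finset U) (p : ℝ)
    (r : GreedyState U → U → Fin 3 → ℝ) (S : GreedyState U) (R : Finset U) : ℝ :=
  labelExp p fun e : E → Fin 3 => greedyTotal ind f r (extendLabel E e) S R

variable {ind : Finset U → Prop} {f : Finset U → ℝ} {E : Finset U} {p : ℝ}

/-- Condition on the label of the pick `x`: the rest of the run never reads it, so what remains is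
again an expectation over all labels. -/
theorem expectedTotal_of_nonempty (r : GreedyState U → U → Fin 3 → ℝ) {S : GreedyState U}
    {R : Finset U} (hR : R ⊆ E) (h : (available ind S.sample R).Nonempty) {x : U}
    (hx : greedyPick f S.sample (available ind S.sample R) h = x) :
    expectedTotal ind f E p r S R =
      1 / 2 * (r S x 0 + expectedTotal ind f E p r (S.next ind x 0) (R.erase x)) +
      p / 2 * (r S x 1 + expectedTotal ind f E p r (S.next ind x 1) (R.erase x)) +
      (1 - p) / 2 * (r S x 2 + expectedTotal ind f E p r (S.next ind x 2) (R.erase x)) := by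
  have hxE : x ∈ E := hR (hx ▸ (greedyPick_mem_available (f := f) h).1)
  have key : ∀ a, labelExp p (fun e : E → Fin 3 =>
      greedyTotal ind f r (extendLabel E (Function.update e ⟨x, hxE⟩ a)) S R) =
      r S x a + expectedTotal ind f E p r (S.next ind x a) (R.erase x) := by
    intro a
    rw [expectedTotal, show r S x a = labelExp p (fun _ : E → Fin 3 => r S x a) from
      (labelExp_const _).symm, ← labelExp_add]
    refine congrArg _ (funext fun e => ?_)
    rw [extendLabel_update, greedyTotal_of_nonempty ind f r _ h hx, Function.update_self,
      greedyTotal_update r _ _ (Finset.notMem_erase _ _)]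
  rw [expectedTotal, labelExp_eq_sum_update _ ⟨x, hxE⟩, Fin.sum_univ_three]
  simp only [key]
  simp [labelProb]

theorem expectedTotal_of_not_nonempty (r : GreedyState U → U → Fin 3 → ℝ) {S : GreedyState U}
    {R : Finset U} (h : ¬ (available ind S.sample R).Nonempty) :
    expectedTotal ind f E p r S R = 0 := by
  simp only [expectedTotal, greedyTotal_of_not_nonempty ind f r _ h]
  exact labelExp_const 0

theorem expectedTotal_growth_nonneg (hmono : Monotone f) (h0 : 0 ≤ p) (h1 : p ≤ 1)
    (S : GreedyState U) {R : Finset U} (hR : R ⊆ E) :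
    0 ≤ expectedTotal ind f E p (growthReward f) S R := by
  induction R using Finset.strongInduction generalizing S with
  | H R ih =>
    by_cases h : (available ind S.sample R).Nonempty
    · have hx := (greedyPick_mem_available (f := f) h).1
      rw [expectedTotal_of_nonempty _ hR h rfl]
      have ih' := fun a => ih _ (Finset.erase_ssubset hx) (S.next ind
        (greedyPick f S.sample (available ind S.sample R) h) a)
        ((Finset.erase_subset _ _).trans hR)
      have hg : 0 ≤ marginal f S.sample (greedyPick f S.sample (available ind S.sample R) h) :=
        sub_nonneg.2 (hmono (Finset.subset_insert _ _))
      have e0 := ih' 0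
      have e1 := mul_nonneg (by linarith : 0 ≤ p / 2) (ih' 1)
      have e2 := mul_nonneg (by linarith : 0 ≤ (1 - p) / 2) (ih' 2)
      simp only [growthReward, Fin.reduceEq, one_ne_zero, if_true, if_false]
      linarith
    · rw [expectedTotal_of_not_nonempty _ h]

/-- The expected loss is small compared to the expected value of the sampled greedy solution. -/
theorem expectedTotal_loss_le (hmono : Monotone f) (h0 : 0 ≤ p) (h1 : p ≤ 1)
    (S : GreedyState U) {R : Finset U} (hR : R ⊆ E) :
    (1 + p) * expectedTotal ind f E p (lossReward f) S R +
      p * (f S.sample + expectedTotal ind f E p (growthReward f) S R) -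
      p * f (S.sample ∪ S.marked) ≤
    p * (1 + p) * expectedTotal ind f E p (growthReward f) S R := by
  induction R using Finset.strongInduction generalizing S with
  | H R ih =>
    by_cases h : (available ind S.sample R).Nonempty
    · have hx := (greedyPick_mem_available (f := f) h).1
      rw [expectedTotal_of_nonempty _ hR h rfl, expectedTotal_of_nonempty _ hR h rfl]
      set x := greedyPick f S.sample (available ind S.sample R) h
      -- Let a and b be the marginals of `x` over the sample and over sample ∪ marked. In
      -- expectation the loss grows by p/2·(a - b), f(sample) by a/2 and f(sample ∪ marked) by (1 +
      -- p)/2·b. So (1 + p)·loss + p·f(sample ∪ marked) grows exactly like p(1 + p)·f(sample); only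
      -- monotonicity at the end of the run loses anything.
      have ih' := fun a => ih _ (Finset.erase_ssubset hx) (S.next ind x a)
        ((Finset.erase_subset _ _).trans hR)
      have i0 := ih' 0
      have i1 := mul_le_mul_of_nonneg_left (ih' 1) (by linarith : 0 ≤ p / 2)
      have i2 := mul_le_mul_of_nonneg_left (ih' 2) (by linarith : 0 ≤ (1 - p) / 2)
      have s0 : (S.next ind x 0).sample = insert x S.sample := by simp [GreedyState.next]
      have s1 : (S.next ind x 1).sample = S.sample := by simp [GreedyState.next]
      have s2 : (S.next ind x 2).sample = S.sample := by simp [GreedyState.next]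
      have m0 : (S.next ind x 0).marked = S.marked := by simp [GreedyState.next]
      have m1 : (S.next ind x 1).marked = insert x S.marked := by simp [GreedyState.next]
      have m2 : (S.next ind x 2).marked = S.marked := by simp [GreedyState.next]
      have fx : f (insert x S.sample) = f S.sample + marginal f S.sample x := by simp [marginal]
      have fx' : f (insert x (S.sample ∪ S.marked)) =
          f (S.sample ∪ S.marked) + marginal f (S.sample ∪ S.marked) x := by simp [marginal]
      rw [s0, m0, Finset.insert_union, fx, fx'] at i0
      rw [s1, m1, Finset.union_insert, fx'] at i1
      rw [s2, m2] at i2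
      simp only [growthReward, lossReward, Fin.reduceEq, one_ne_zero, zero_ne_one, if_true,
        if_false]
      linarith
    · rw [expectedTotal_of_not_nonempty _ h, expectedTotal_of_not_nonempty _ h]
      have := mul_le_mul_of_nonneg_left
        (hmono (Finset.subset_union_left : S.sample ⊆ S.sample ∪ S.marked)) h0
      linarith

variable {M : Matroid U}

/-- The fundamental circuit of `x` in `S ∪ O` cannot lie inside the independent set `insert x S`, so
it contains an element of `O` outside `S` that can be exchanged for `x`. -/
theorem exists_erase_indep {S O : Finset U} {x : U}
    (hSO : M.Indep ((S ∪ O : Finset U) : Set U)) (hx : M.Indep ((insert x S : Finset U) : Set U))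
    (hxSO : x ∉ S ∪ O) :
    M.Indep ((insert x S ∪ O : Finset U) : Set U) ∨
      ∃ o ∈ O, o ∉ S ∧ M.Indep ((insert x S ∪ O.erase o : Finset U) : Set U) := by
  by_cases hcl : x ∈ M.closure ((S ∪ O : Finset U) : Set U)
  · right
    have hcirc := hSO.fundCircuit_isCircuit hcl (by simpa using hxSO)
    have hns : ¬ M.fundCircuit x ((S ∪ O : Finset U) : Set U) ⊆ ((insert x S : Finset U) : Set U) :=
      fun hss => hcirc.not_indep (hx.subset hss)
    obtain ⟨o, ho, hoS⟩ := Set.not_subset.1 hns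
    have hoU := M.fundCircuit_subset_insert _ _ ho
    have hmem := (hSO.mem_fundCircuit_iff hcl (by simpa using hxSO)).1 ho
    have hoS' : o ≠ x ∧ o ∉ S := by simpa using hoS
    refine ⟨o, ?_, hoS'.2, hmem.subset ?_⟩
    · simpa [hoS'.1, hoS'.2] using hoU
    · intro y hy
      simp only [Finset.coe_union, Finset.coe_insert, Finset.coe_erase, Set.mem_union,
        Set.mem_insert_iff, Set.mem_sdiff, Finset.mem_coe, Set.mem_singleton_iff] at hy ⊢
      rcases hy with (rfl | hy) | hy
      · exact ⟨Or.inl rfl, hoS'.1.symm⟩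
      · exact ⟨Or.inr (Or.inl hy), fun h => hoS'.2 (h ▸ hy)⟩
      · exact ⟨Or.inr (Or.inr hy.1), hy.2⟩
  · left
    have hxE : x ∈ M.E := hx.subset_ground (by simp)
    have := ((hSO.notMem_closure_iff hxE).1 hcl).1
    rwa [← Finset.coe_insert, ← Finset.insert_union] at this

/-- The sampled part of the greedy solution is a `2`-approximation in expectation. -/
theorem le_expectedTotal_growth (hmono : Monotone f)
    (hsub : ∀ A B, A ⊆ B → ∀ x, marginal f B x ≤ marginal f A x) (h0 : 0 ≤ p) (h1 : p ≤ 1)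
    (S : GreedyState U) {R O : Finset U} (hR : R ⊆ E) (hRS : Disjoint R S.sample) (hO : O ⊆ R)
    (hind : M.Indep ((S.sample ∪ O : Finset U) : Set U)) :
    f (S.sample ∪ O) + f S.sample ≤ 2 * (f S.sample +
      expectedTotal (fun T => M.Indep (T : Set U)) f E p (growthReward f) S R) := by
  induction R using Finset.strongInduction generalizing S O with
  | H R ih =>
    by_cases h : (available (fun T => M.Indep (T : Set U)) S.sample R).Nonempty
    · obtain ⟨hx, hxI⟩ := greedyPick_mem_available (f := f) h
      have hmax := (greedyPick_spec f S.sample _ h).2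
      rw [expectedTotal_of_nonempty _ hR h rfl]
      set x := greedyPick f S.sample (available (fun T => M.Indep (T : Set U)) S.sample R) h
      have hxS : x ∉ S.sample := Finset.disjoint_left.1 hRS hx
      have ih' := fun a O' => @ih _ (Finset.erase_ssubset hx)
        (S.next (fun T => M.Indep (T : Set U)) x a) O'
        ((Finset.erase_subset _ _).trans hR)
      have s0 : (S.next (fun T => M.Indep (T : Set U)) x 0).sample = insert x S.sample := by
        simp [GreedyState.next]
      have s1 : (S.next (fun T => M.Indep (T : Set U)) x 1).sample = S.sample := by
        simp [GreedyState.next]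
      have s2 : (S.next (fun T => M.Indep (T : Set U)) x 2).sample = S.sample := by
        simp [GreedyState.next]
      have d0 : Disjoint (R.erase x) (insert x S.sample) := by
        rw [Finset.disjoint_insert_right]
        exact ⟨Finset.notMem_erase _ _, hRS.mono_left (Finset.erase_subset _ _)⟩
      have d1 : Disjoint (R.erase x) S.sample := hRS.mono_left (Finset.erase_subset _ _)
      have fx : f (insert x S.sample) = f S.sample + marginal f S.sample x := by simp [marginal]
      have i0 := ih' 0
      have i1 := ih' 1
      have i2 := ih' 2
      rw [s0, fx] at i0
      rw [s1] at i1
      rw [s2] at i2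
      -- Every such `o` is available, so greedy values `x` at least as highly; by submodularity
      -- dropping `o` costs at most the marginal of `x`.
      have drop : ∀ o ∈ O, o ∉ S.sample →
          f (S.sample ∪ O) ≤ f (S.sample ∪ O.erase o) + marginal f S.sample x := by
        intro o ho hoS
        have hoA : o ∈ available (fun T => M.Indep (T : Set U)) S.sample R := by
          simp only [available, Finset.mem_filter]
          exact ⟨hO ho, hind.subset (Finset.coe_subset.2 (Finset.insert_subset
            (Finset.mem_union_right _ ho) Finset.subset_union_left))⟩
        have e1 := hmax o hoA
        have e2 := hsub S.sample (S.sample ∪ O.erase o) Finset.subset_union_left o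
        have e3 : insert o (S.sample ∪ O.erase o) = S.sample ∪ O := by
          rw [← Finset.union_insert, Finset.insert_erase ho]
        have e4 : marginal f (S.sample ∪ O.erase o) o =
          f (S.sample ∪ O) - f (S.sample ∪ O.erase o) := by rw [marginal, e3]
        linarith
      -- Labels 1 and 2 have total probability 1/2 and share a bound, so `p` cancels.
      have combine : ∀ c0 c1 G0 G1 G2 : ℝ, c0 ≤ 2 * G0 → c1 ≤ 2 * G1 → c1 ≤ 2 * G2 →
          c0 / 2 + c1 / 2 ≤ 2 * (1 / 2 * G0 + p / 2 * G1 + (1 - p) / 2 * G2) := by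
        intro c0 c1 G0 G1 G2 e0 e1 e2
        have f1 := mul_le_mul_of_nonneg_left e1 (by linarith : 0 ≤ p / 2)
        have f2 := mul_le_mul_of_nonneg_left e2 (by linarith : 0 ≤ (1 - p) / 2)
        linarith
      simp only [growthReward, Fin.reduceEq, one_ne_zero, if_true, if_false]
      -- The potential f(S ∪ O) + f(S) does not decrease in expectation. For `x` in `O`, sampling
      -- adds its marginal to f(S), while skipping removes at most as much from f(S ∪ O). For `x`
      -- outside `O`, sampling costs at most one element of `O`, paid by the growth of f(S), and
      -- skipping costs nothing.
      by_cases hxO : x ∈ O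
      · have hsubO : O.erase x ⊆ R.erase x := Finset.erase_subset_erase _ hO
        have hins : insert x S.sample ∪ O.erase x = S.sample ∪ O := by
          rw [Finset.insert_union, ← Finset.union_insert, Finset.insert_erase hxO]
        have j0 := i0 _ d0 hsubO (by rwa [hins])
        have hind' : M.Indep ((S.sample ∪ O.erase x : Finset U) : Set U) :=
          hind.subset (Finset.coe_subset.2
            (Finset.union_subset_union_right (Finset.erase_subset _ _)))
        have j1 := i1 _ d1 hsubO hind'
        have j2 := i2 _ d1 hsubO hind'
        rw [hins] at j0
        have := drop x hxO hxS
        have := combine _ _ _ _ _ j0 j1 j2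
        linarith
      · have hsubO : O ⊆ R.erase x := Finset.subset_erase.2 ⟨hO, hxO⟩
        have j1 := i1 _ d1 hsubO hind
        have j2 := i2 _ d1 hsubO hind
        rcases exists_erase_indep hind hxI (by simp [hxS, hxO]) with hO' | ⟨o, ho, hoS, hO'⟩
        · have j0 := i0 _ d0 hsubO hO'
          have hle : f (S.sample ∪ O) ≤ f (insert x S.sample ∪ O) :=
            hmono (Finset.union_subset_union_left (Finset.subset_insert _ _))
          have hg : 0 ≤ marginal f S.sample x := sub_nonneg.2 (hmono (Finset.subset_insert _ _))
          have := combine _ _ _ _ _ j0 j1 j2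
          linarith
        · have j0 := i0 _ d0 ((Finset.erase_subset _ _).trans hsubO) hO'
          have hle : f (S.sample ∪ O.erase o) ≤ f (insert x S.sample ∪ O.erase o) :=
            hmono (Finset.union_subset_union_left (Finset.subset_insert _ _))
          have := drop o ho hoS
          have := combine _ _ _ _ _ j0 j1 j2
          linarith
    · rw [expectedTotal_of_not_nonempty _ h]
      -- Any remaining element of `O` would be available, so the run ends only with `O` empty.
      have hOe : O = ∅ := by
        rw [Finset.not_nonempty_iff_eq_empty] at h
        refine Finset.eq_empty_of_forall_notMem fun o ho => ?_
        have : o ∈ available (fun T => M.Indep (T : Set U)) S.sample R := by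
          simp only [available, Finset.mem_filter]
          exact ⟨hO ho, hind.subset (Finset.coe_subset.2 (Finset.insert_subset
            (Finset.mem_union_right _ ho) Finset.subset_union_left))⟩
        simp [h] at this
      rw [hOe, Finset.union_empty]
      linarith

/-- The chosen elements have a large expected weight. The number `k` bounds the rank of the chosen
elements in the contraction of the sampled ones. -/
theorem le_expectedTotal_chosen (hmono : Monotone f)
    (hsub : ∀ A B, A ⊆ B → ∀ x, marginal f B x ≤ marginal f A x) (h0 : 0 ≤ p) (h1 : p ≤ 1)
    (S : GreedyState U) {R : Finset U} (hR : R ⊆ E) (hRS : Disjoint R S.sample)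
    (hchosen : M.Indep (S.chosen : Set U)) {k : ℕ}
    (hk : M.eRk ((S.sample : Set U) ∪ S.chosen) ≤ S.sample.card + k) {g : ℝ}
    (hg : ∀ y ∈ available (fun T => M.Indep (T : Set U)) S.sample R, marginal f S.sample y ≤ g)
    (hg0 : 0 ≤ g) :
    p * expectedTotal (fun T => M.Indep (T : Set U)) f E p (growthReward f) S R ≤
      (1 + p) * expectedTotal (fun T => M.Indep (T : Set U)) f E p
        (chosenReward (fun T => M.Indep (T : Set U)) f) S R + p * g * k := by
  induction R using Finset.strongInduction generalizing S k g with
  | H R ih =>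
    by_cases h : (available (fun T => M.Indep (T : Set U)) S.sample R).Nonempty
    · obtain ⟨hx, hxI⟩ := greedyPick_mem_available (f := f) h
      obtain ⟨hxA, hmax⟩ := greedyPick_spec f S.sample _ h
      rw [expectedTotal_of_nonempty _ hR h rfl, expectedTotal_of_nonempty _ hR h rfl]
      set x := greedyPick f S.sample (available (fun T => M.Indep (T : Set U)) S.sample R) h
      have hxS : x ∉ S.sample := Finset.disjoint_left.1 hRS hx
      have hxE : x ∈ M.E := hxI.subset_ground (by simp)
      have hgx : 0 ≤ marginal f S.sample x := sub_nonneg.2 (hmono (Finset.subset_insert _ _))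
      have hgG : p * marginal f S.sample x * k ≤ p * g * k :=
        mul_le_mul_of_nonneg_right (mul_le_mul_of_nonneg_left (hg x hxA) h0) (Nat.cast_nonneg k)
      have d0 : Disjoint (R.erase x) (insert x S.sample) := by
        rw [Finset.disjoint_insert_right]
        exact ⟨Finset.notMem_erase _ _, hRS.mono_left (Finset.erase_subset _ _)⟩
      have d1 : Disjoint (R.erase x) S.sample := hRS.mono_left (Finset.erase_subset _ _)
      -- Greedy marginals never increase along the run, so the marginal of `x` serves as the next
      -- `g`.
      have bound : ∀ T, S.sample ⊆ T →
          ∀ y ∈ available (fun T => M.Indep (T : Set U)) T (R.erase x),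
          marginal f T y ≤ marginal f S.sample x := by
        intro T hT y hy
        simp only [available, Finset.mem_filter] at hy
        refine (hsub _ _ hT y).trans (hmax y ?_)
        simp only [available, Finset.mem_filter]
        exact ⟨Finset.mem_of_mem_erase hy.1, hy.2.subset (Finset.coe_subset.2
          (Finset.insert_subset_insert _ hT))⟩
      have ih' := fun a => ih _ (Finset.erase_ssubset hx)
        (S.next (fun T => M.Indep (T : Set U)) x a)
        ((Finset.erase_subset _ _).trans hR)
      have s0 : (S.next (fun T => M.Indep (T : Set U)) x 0).sample = insert x S.sample := by
        simp [GreedyState.next]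
      have s1 : (S.next (fun T => M.Indep (T : Set U)) x 1).sample = S.sample := by
        simp [GreedyState.next]
      have s2 : (S.next (fun T => M.Indep (T : Set U)) x 2).sample = S.sample := by
        simp [GreedyState.next]
      have c0 : (S.next (fun T => M.Indep (T : Set U)) x 0).chosen = S.chosen := by
        simp [GreedyState.next]
      have c2 : (S.next (fun T => M.Indep (T : Set U)) x 2).chosen = S.chosen := by
        simp [GreedyState.next]
      have i0 := ih' 0
      have i1 := ih' 1
      have i2 := ih' 2
      rw [s2, c2] at i2
      have j2 := mul_le_mul_of_nonneg_left (i2 d1 hchosen hk (bound _ subset_rfl) hgx)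
        (by linarith : 0 ≤ (1 - p) / 2)
      rw [s0, c0, Finset.coe_insert, Finset.card_insert_of_notMem hxS, Set.insert_union] at i0
      rw [s1] at i1
      simp only [growthReward, chosenReward, Fin.reduceEq, one_ne_zero, zero_ne_one, if_true,
        if_false, false_and, true_and]
      -- Here sampling `x` enlarges the sample but not the rank of the union, so `k` drops by one
      -- and the released credit pays for the growth. There is such a credit: the independent set
      -- `insert x S.sample` lies in the closure of the union, which forces `k ≥ 1`.
      by_cases hcl : x ∈ M.closure ((S.sample : Set U) ∪ S.chosen)
      · have hrk : M.eRk (insert x ((S.sample : Set U) ∪ S.chosen)) =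
            M.eRk ((S.sample : Set U) ∪ S.chosen) := by
          rw [← M.eRk_closure_eq, Matroid.closure_insert_eq_of_mem_closure hcl, M.eRk_closure_eq]
        have hk1 : 1 ≤ k := by
          have e1 : ((insert x S.sample : Finset U) : Set U).encard ≤
              M.eRk (insert x ((S.sample : Set U) ∪ S.chosen)) := by
            refine hxI.encard_le_eRk_of_subset ?_
            rw [Finset.coe_insert]
            exact Set.insert_subset_insert Set.subset_union_left
          rw [Set.encard_coe_eq_coe_finsetCard, Finset.card_insert_of_notMem hxS, hrk] at e1
          have e2 := e1.trans hk
          norm_cast at e2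
          omega
        obtain ⟨k, rfl⟩ := Nat.exists_eq_add_of_le' hk1
        have j0 := i0 d0 hchosen (k := k) (by
          rw [hrk]; refine hk.trans (le_of_eq ?_); push_cast; ring)
          (bound _ (Finset.subset_insert _ _)) hgx
        by_cases hxc : M.Indep ((insert x S.chosen : Finset U) : Set U)
        · have c1 : (S.next (fun T => M.Indep (T : Set U)) x 1).chosen = insert x S.chosen := by
            simp only [GreedyState.next, true_and, if_pos hxc]
          rw [c1] at i1
          have j1 := mul_le_mul_of_nonneg_left (i1 d1 hxc (k := k + 1) (by
            rw [Finset.coe_insert, Set.union_insert, hrk]; exact hk) (bound _ subset_rfl) hgx)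
            (by linarith : 0 ≤ p / 2)
          have hpp := mul_nonneg (mul_nonneg h0 h0) hgx
          have hp := mul_nonneg h0 hgx
          rw [if_pos hxc]
          push_cast at *
          linarith
        · have c1 : (S.next (fun T => M.Indep (T : Set U)) x 1).chosen = S.chosen := by
            simp only [GreedyState.next, true_and, if_neg hxc]
          rw [c1] at i1
          have j1 := mul_le_mul_of_nonneg_left (i1 d1 hchosen hk (bound _ subset_rfl) hgx)
            (by linarith : 0 ≤ p / 2)
          rw [if_neg hxc]
          push_cast at *
          linarith
      -- Now label 1 means that `x` is chosen: it earns 1 + p times its marginal and pays p times it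
      -- for raising `k`. The net marginal, with probability p/2, matches p times the growth at
      -- label 0, with probability 1/2.
      · have hxc : M.Indep ((insert x S.chosen : Finset U) : Set U) := by
          rw [Finset.coe_insert]
          exact ((hchosen.notMem_closure_iff hxE).1 fun hmem =>
            hcl (M.closure_subset_closure Set.subset_union_right hmem)).1
        have hrk : M.eRk (insert x ((S.sample : Set U) ∪ S.chosen)) ≤ S.sample.card + k + 1 :=
          (M.eRk_insert_le_add_one _ _).trans (by gcongr)
        have j0 := i0 d0 hchosen (k := k) (hrk.trans (le_of_eq (by push_cast; ring)))
          (bound _ (Finset.subset_insert _ _)) hgx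
        have c1 : (S.next (fun T => M.Indep (T : Set U)) x 1).chosen = insert x S.chosen := by
          simp only [GreedyState.next, true_and, if_pos hxc]
        rw [c1] at i1
        have j1 := mul_le_mul_of_nonneg_left (i1 d1 hxc (k := k + 1) (by
          rw [Finset.coe_insert, Set.union_insert]
          exact hrk.trans (le_of_eq (by push_cast; ring))) (bound _ subset_rfl) hgx)
          (by linarith : 0 ≤ p / 2)
        rw [if_pos hxc]
        push_cast at *
        linarith
    · rw [expectedTotal_of_not_nonempty _ h, expectedTotal_of_not_nonempty _ h]
      have := mul_nonneg (mul_nonneg h0 hg0) (Nat.cast_nonneg (α := ℝ) k)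
      linarith

end GreedyExpectation

/-! ### Enforcing independence on every matroid. -/

section Guarded

open Classical

variable {U : Type u}

/-- The view after the first `k` arrivals. -/
noncomputable def View.truncate (V : View U) (k : ℕ) : View U where
  arrived := V.arrived.take k
  value S := if S ⊆ (V.arrived.take k).toFinset then V.value S else 0
  indep S := S ⊆ (V.arrived.take k).toFinset ∧ V.indep S

/-- Earlier views can be recovered from the current one, so earlier decisions can be recomputed. -/
theorem truncate_observe (M : Matroid U) (f : Finset U → ℝ) (l : List U) (k : ℕ) :
    (observe M f l).truncate k = observe M f (l.take k) := by
  have hsub : (l.take k).toFinset ⊆ l.toFinset := fun x hx => by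
    rw [List.mem_toFinset] at hx ⊢; exact List.mem_of_mem_take hx
  simp only [View.truncate, observe, View.mk.injEq, true_and]
  constructor
  · funext S
    by_cases h1 : S ⊆ (l.take k).toFinset
    · exact (if_pos h1).trans ((if_pos (h1.trans hsub)).trans (if_pos h1).symm)
    · exact (if_neg h1).trans (if_neg h1).symm
  · funext S
    exact propext ⟨fun h => ⟨h.1, h.2.2⟩, fun h => ⟨h.1, h.1.trans hsub, h.2⟩⟩

/-- Only finitely many binary decisions matter, and every set of patterns of these is measurable. -/
theorem measurableSet_of_finite_family {Ω ι : Type*} [MeasurableSpace Ω] [Finite ι]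
    {B : ι → Ω → Prop} (hB : ∀ i, MeasurableSet {ω | B i ω}) (P : (ι → Prop) → Prop) :
    MeasurableSet {ω | P fun i => B i ω} := by
  have hmeas : Measurable fun ω i => B i ω :=
    measurable_pi_iff.2 fun i => measurableSet_setOfPred.1 (hB i)
  exact hmeas (Set.toFinite {q | P q}).measurableSet

namespace OnlineAlgorithm

/-- The elements that the algorithm accepted up to the current arrival. -/
noncomputable def acceptedSoFar (A : OnlineAlgorithm.{u, v} U) (n : ℕ) (ω : A.Seed n)
    (V : View U) : Finset U :=
  (Finset.univ.filter fun k : Fin V.arrived.length =>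
    A.accepts n ω (V.truncate (k.val + 1))).image V.arrived.get

/-- The algorithm that accepts an element only if all elements that `A` accepted so far form an
independent set. -/
noncomputable abbrev guarded (A : OnlineAlgorithm.{u, v} U) : OnlineAlgorithm.{u, v} U where
  Seed := A.Seed
  seedSpace := A.seedSpace
  law := A.law
  law_prob := A.law_prob
  accepts n ω V := A.accepts n ω V ∧ V.indep (A.acceptedSoFar n ω V)
  measurable_accepts n V := by
    refine (A.measurable_accepts n V).inter ?_
    exact measurableSet_of_finite_family (ι := Fin V.arrived.length)
      (B := fun k ω => A.accepts n ω (V.truncate (k.val + 1)))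
      (fun k => A.measurable_accepts n _)
      fun q => V.indep ((Finset.univ.filter fun k => q k).image V.arrived.get)

variable (A : OnlineAlgorithm.{u, v} U) (E : Finset U) (M : Matroid U) (f : Finset U → ℝ)
  (π : Fin E.card ≃ E)

theorem mem_output {ω : A.Seed E.card} {x : U} :
    x ∈ A.output E M f π ω ↔ ∃ i : Fin E.card, A.accepts E.card ω
      (observe M f ((List.ofFn fun j => (π j : U)).take (i.val + 1))) ∧ (π i : U) = x := by
  simp [output]

theorem mem_acceptedSoFar {ω : A.Seed E.card} {x : U} (i : Fin E.card) :
    x ∈ A.acceptedSoFar E.card ω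
        (observe M f ((List.ofFn fun j => (π j : U)).take (i.val + 1))) ↔
      ∃ j ≤ i, A.accepts E.card ω
        (observe M f ((List.ofFn fun j => (π j : U)).take (j.val + 1))) ∧ (π j : U) = x := by
  simp only [acceptedSoFar, Finset.mem_image, Finset.mem_filter, Finset.mem_univ, true_and,
    truncate_observe]
  have hlen : (observe M f ((List.ofFn fun j => (π j : U)).take (i.val + 1))).arrived.length =
      i.val + 1 := by
    simp only [observe, List.length_take, List.length_ofFn]
    have := i.2
    omega
  constructor
  · rintro ⟨⟨k, hkl⟩, hk, rfl⟩
    have hki : k ≤ i.val := by omega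
    refine ⟨⟨k, by have := i.2; omega⟩, hki, ?_, ?_⟩
    · rwa [List.take_take, min_eq_left (by omega)] at hk
    · simp [observe]
  · rintro ⟨j, hji, hj, rfl⟩
    have hji' : j.val ≤ i.val := hji
    refine ⟨⟨j.val, by omega⟩, ?_, ?_⟩
    · rwa [List.take_take, min_eq_left (by simpa using hji)]
    · simp [observe]

/-- At the last acceptance the guard has tested a set that contains the whole output. -/
theorem indep_output_guarded (ω : A.Seed E.card) :
    M.Indep (A.guarded.output E M f π ω : Set U) := by
  rcases (A.guarded.output E M f π ω).eq_empty_or_nonempty with h | ⟨y, hy⟩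
  · rw [h]; simp
  · obtain ⟨k, hk, -⟩ := (mem_output _ _ _ _ _).1 hy
    obtain ⟨i, hi, hmax⟩ := Finset.exists_max_image
      (Finset.univ.filter fun i : Fin E.card => A.guarded.accepts E.card ω
        (observe M f ((List.ofFn fun j => (π j : U)).take (i.val + 1)))) id
      ⟨k, Finset.mem_filter.2 ⟨Finset.mem_univ _, hk⟩⟩
    refine (Finset.mem_filter.1 hi).2.2.2.subset (Finset.coe_subset.2 fun x hx => ?_)
    obtain ⟨j, hj, rfl⟩ := (mem_output _ _ _ _ _).1 hx
    exact (mem_acceptedSoFar _ _ _ _ _ i).2 ⟨j,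
      hmax j (Finset.mem_filter.2 ⟨Finset.mem_univ _, hj⟩), hj.1, rfl⟩

/-- The guard only tests subsets of the output of `A`, so it is idle when that output is
independent. -/
theorem output_guarded_eq {ω : A.Seed E.card} (h : M.Indep (A.output E M f π ω : Set U)) :
    A.guarded.output E M f π ω = A.output E M f π ω := by
  ext x
  rw [mem_output, mem_output]
  refine exists_congr fun i => and_congr_left fun _ => ⟨fun hi => hi.1, fun hi => ⟨hi, ?_, ?_⟩⟩
  · intro y hy
    obtain ⟨j, hj, -, rfl⟩ := (mem_acceptedSoFar A E M f π i).1 hy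
    rw [List.mem_toFinset, List.mem_take_iff_getElem]
    exact ⟨j.val, by simpa using hj, by simp⟩
  · refine h.subset (Finset.coe_subset.2 fun y hy => ?_)
    obtain ⟨j, -, hj⟩ := (mem_acceptedSoFar A E M f π i).1 hy
    exact (mem_output A E M f π).2 ⟨j, hj⟩

end OnlineAlgorithm

end Guarded

/-! ### Simulating the linear instance online. -/

section Simulation

open Classical

variable {U : Type u} {n : ℕ}

/-- The permutation that maps an arrival time to the time of the simulated arrival: the positions
of label `0` are filled first. -/
noncomputable def simulationOrder (s : Fin n → Fin 3) : Equiv.Perm (Fin n) :=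
  Tuple.sort fun j => if s j = 0 then (0 : ℕ) else 1

/-- The sort is stable: positions of nonzero label come in increasing order after all positions of
label 0. When one of them is reached, its entire simulated past has arrived. -/
theorem simulationOrder_le (s : Fin n → Fin 3) {i i' : Fin n} (hi : s (simulationOrder s i) ≠ 0)
    (h : simulationOrder s i' ≤ simulationOrder s i) : i' ≤ i := by
  by_contra hlt
  rw [not_le] at hlt
  obtain ⟨hmono, hstable⟩ := Tuple.eq_sort_iff.1 (rfl : simulationOrder s = _)
  have h1 := hmono hlt.le
  simp only [Function.comp_apply, if_neg hi] at h1
  have h2 : s (simulationOrder s i') ≠ 0 := fun h0 => by simp [h0] at h1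
  exact absurd (hstable i i' hlt (by simp [hi, h2])) (not_lt.2 h)

theorem le_of_label_eq_zero (s : Fin n → Fin 3) {i i' : Fin n}
    (hi : s (simulationOrder s i) ≠ 0) (hi' : s (simulationOrder s i') = 0) : i' ≤ i := by
  by_contra hlt
  rw [not_le] at hlt
  have h1 := (Tuple.eq_sort_iff.1 (rfl : simulationOrder s = _)).1 hlt.le
  simp [hi, hi'] at h1

/-- The label of an arrived element. -/
noncomputable def viewLabel (s : Fin n → Fin 3) (V : View U) (x : U) : Fin 3 :=
  if h : ∃ i : Fin n, V.arrived[i.val]? = some x then s (simulationOrder s h.choose) else 2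

/-- The weight of an arrived element in the simulated linear instance. -/
noncomputable def viewWeight (s : Fin n → Fin 3) (V : View U) (x : U) : ℝ :=
  if viewLabel s V x = 1 then
    greedyWeight V.indep V.value (viewLabel s V) ∅
      (insert x (V.arrived.toFinset.filter fun y => viewLabel s V y = 0)) x
  else 0

/-- The simulated arrivals up to the one that corresponds to the arrival time `i`. -/
noncomputable def simulatedArrivals (s : Fin n → Fin 3) (V : View U) (i : Fin n) : List U :=
  ((List.finRange n).take ((simulationOrder s i).val + 1)).filterMap fun j =>
    V.arrived[((simulationOrder s).symm j).val]?

/-- The view in the simulated linear instance. -/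
noncomputable def simulatedView (s : Fin n → Fin 3) (V : View U) (i : Fin n) : View U where
  arrived := simulatedArrivals s V i
  value S := if S ⊆ (simulatedArrivals s V i).toFinset then ∑ x ∈ S, viewWeight s V x else 0
  indep S := S ⊆ (simulatedArrivals s V i).toFinset ∧ V.indep S

/-- The weights of the linear instance that belongs to the labels `t`. -/
noncomputable def linearWeight (E : Finset U) (M : Matroid U) (f : Finset U → ℝ) (t : U → Fin 3)
    (x : U) : ℝ :=
  if t x = 1 then greedyWeight (fun S => M.Indep (S : Set U)) f t ∅ E x else 0

variable {E : Finset U} {M : Matroid U} {f : Finset U → ℝ}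

theorem extendLabel_comp_symm (e : Fin E.card → Fin 3) (π : Fin E.card ≃ E) (j : Fin E.card) :
    extendLabel E (e ∘ π.symm) (π j) = e j := by
  simp [extendLabel]

theorem mem_take_ofFn {π : Fin E.card ≃ E} {i : Fin E.card} {x : U} :
    x ∈ (List.ofFn fun j => (π j : U)).take (i.val + 1) ↔ ∃ j ≤ i, (π j : U) = x := by
  rw [List.mem_take_iff_getElem]
  constructor
  · rintro ⟨k, hk, rfl⟩
    simp only [List.length_ofFn, lt_inf_iff] at hk
    exact ⟨⟨k, hk.2⟩, Fin.mk_le_of_le_val (Nat.lt_succ_iff.1 hk.1), by simp⟩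
  · rintro ⟨j, hj, rfl⟩
    exact ⟨j.val, by simpa using hj, by simp⟩

theorem getElem?_take_ofFn {π : Fin E.card ≃ E} {i j : Fin E.card} (h : j ≤ i) :
    ((List.ofFn fun j => (π j : U)).take (i.val + 1))[j.val]? = some (π j : U) := by
  rw [List.getElem?_take_of_lt (by have : j.val ≤ i.val := h; omega)]
  simp

variable {s : Fin E.card → Fin 3} {π : Fin E.card ≃ E} {i : Fin E.card}

theorem viewLabel_observe {x : U}
    (hx : x ∈ (List.ofFn fun j => (π j : U)).take (i.val + 1)) :
    viewLabel s (observe M f ((List.ofFn fun j => (π j : U)).take (i.val + 1))) x =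
      extendLabel E (s ∘ ((simulationOrder s).symm.trans π).symm) x := by
  obtain ⟨j, hj, rfl⟩ := mem_take_ofFn.1 hx
  have hex : ∃ k : Fin E.card,
      (observe M f ((List.ofFn fun j => (π j : U)).take (i.val + 1))).arrived[k.val]? =
        some (π j : U) := ⟨j, getElem?_take_ofFn hj⟩
  rw [viewLabel, dif_pos hex]
  have hk : hex.choose = j := by
    have hspec := hex.choose_spec
    set k := hex.choose
    simp only [observe] at hspec
    rw [List.getElem?_take] at hspec
    split_ifs at hspec
    simpa using hspec
  rw [hk]
  have := extendLabel_comp_symm s ((simulationOrder s).symm.trans π) (simulationOrder s j)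
  simpa using this.symm

theorem simulatedArrivals_observe (hi : s (simulationOrder s i) ≠ 0) :
    simulatedArrivals s (observe M f ((List.ofFn fun j => (π j : U)).take (i.val + 1))) i =
      (List.ofFn fun j => ((simulationOrder s).symm.trans π j : U)).take
        ((simulationOrder s i).val + 1) := by
  have hmem : ∀ j ∈ (List.finRange E.card).take ((simulationOrder s i).val + 1),
      (observe M f ((List.ofFn fun j => (π j : U)).take (i.val + 1))).arrived[
        ((simulationOrder s).symm j).val]? =
      (some ∘ fun j => ((simulationOrder s).symm.trans π j : U)) j := by
    intro j hj
    obtain ⟨k, hk, rfl⟩ := List.mem_take_iff_getElem.1 hj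
    simp only [List.length_finRange, lt_inf_iff] at hk
    refine getElem?_take_ofFn (simulationOrder_le s hi ?_)
    simp only [List.getElem_finRange, Fin.cast_mk, Equiv.apply_symm_apply]
    exact Fin.mk_le_of_le_val (Nat.lt_succ_iff.1 hk.1)
  rw [simulatedArrivals, List.filterMap_congr hmem, List.filterMap_eq_map, List.map_take,
    List.ofFn_eq_map]

/-- At a position of nonzero label the whole sample has arrived, and the weight of `x` depends only
on the sample and on `x`. -/
theorem viewWeight_observe (hi : s (simulationOrder s i) ≠ 0) {x : U}
    (hx : x ∈ (List.ofFn fun j => (π j : U)).take (i.val + 1)) :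
    viewWeight s (observe M f ((List.ofFn fun j => (π j : U)).take (i.val + 1))) x =
      linearWeight E M f (extendLabel E (s ∘ ((simulationOrder s).symm.trans π).symm)) x := by
  set T := extendLabel E (s ∘ ((simulationOrder s).symm.trans π).symm) with hT
  set l := (List.ofFn fun j => (π j : U)).take (i.val + 1) with hl
  have hxE : x ∈ E := by
    obtain ⟨j, -, rfl⟩ := mem_take_ofFn.1 hx
    exact (π j).2
  have hlabel : ∀ y ∈ l, viewLabel s (observe M f l) y = T y := fun y hy => viewLabel_observe hy
  have hfilter : (observe M f l).arrived.toFinset.filter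
      (fun y => viewLabel s (observe M f l) y = 0) = E.filter fun y => T y = 0 := by
    ext y
    rw [Finset.mem_filter, Finset.mem_filter]
    change y ∈ l.toFinset ∧ _ ↔ _
    rw [List.mem_toFinset]
    constructor
    · rintro ⟨hy, h0⟩
      refine ⟨?_, (hlabel y hy).symm.trans h0⟩
      obtain ⟨j, -, rfl⟩ := mem_take_ofFn.1 hy
      exact (π j).2
    · rintro ⟨hy, h0⟩
      have hyl : y ∈ l := by
        have hj := extendLabel_comp_symm s ((simulationOrder s).symm.trans π)
          (simulationOrder s (π.symm ⟨y, hy⟩))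
        simp only [Equiv.trans_apply, Equiv.symm_apply_apply, Equiv.apply_symm_apply] at hj
        refine mem_take_ofFn.2 ⟨π.symm ⟨y, hy⟩, le_of_label_eq_zero s hi ?_, by simp⟩
        rw [← hj]; exact h0
      exact ⟨hyl, (hlabel y hyl).trans h0⟩
  have hsub : ∅ ∪ insert x (E.filter fun y => T y = 0) ⊆ l.toFinset := by
    rw [Finset.empty_union, ← hfilter]
    exact Finset.insert_subset (List.mem_toFinset.2 hx) (Finset.filter_subset _ _)
  rw [viewWeight, linearWeight, hlabel x hx, hfilter]
  refine if_congr Iff.rfl ?_ rfl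
  rw [← greedyWeight_insert_sample T ∅ hxE]
  refine congrFun (greedyWeight_congr (fun S hS => ?_) (fun S hS => ?_) fun y hy => ?_) x
  · simp only [observe, and_iff_right_iff_imp]
    exact fun _ => hS.trans hsub
  · simp only [observe, if_pos (hS.trans hsub)]
  · exact hlabel y (List.mem_toFinset.1 (hsub (by simpa using hy)))

theorem simulatedView_observe (hi : s (simulationOrder s i) ≠ 0) :
    simulatedView s (observe M f ((List.ofFn fun j => (π j : U)).take (i.val + 1))) i =
      observe M (fun S => ∑ x ∈ S,
          linearWeight E M f (extendLabel E (s ∘ ((simulationOrder s).symm.trans π).symm)) x)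
        ((List.ofFn fun j => ((simulationOrder s).symm.trans π j : U)).take
          ((simulationOrder s i).val + 1)) := by
  have hsub : ((List.ofFn fun j => ((simulationOrder s).symm.trans π j : U)).take
      ((simulationOrder s i).val + 1)).toFinset ⊆
      ((List.ofFn fun j => (π j : U)).take (i.val + 1)).toFinset := by
    intro x hx
    rw [List.mem_toFinset, mem_take_ofFn] at hx ⊢
    obtain ⟨j, hj, rfl⟩ := hx
    exact ⟨(simulationOrder s).symm j, simulationOrder_le s hi (by simpa using hj), rfl⟩
  simp only [simulatedView, simulatedArrivals_observe hi]
  simp only [observe, View.mk.injEq, true_and]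
  constructor
  · funext S
    split_ifs with h
    · refine Finset.sum_congr rfl fun x hx => viewWeight_observe hi ?_
      exact List.mem_toFinset.1 (hsub (h hx))
    · rfl
  · funext S
    exact propext ⟨fun h => ⟨h.1, h.2.2⟩, fun h => ⟨h.1, h.1.trans hsub, h.2⟩⟩

end Simulation

/-! ### Expectations in terms of the output distribution. -/

section OutputDistribution

open Classical MeasureTheory

variable {U : Type u}

namespace OnlineAlgorithm

variable (A : OnlineAlgorithm.{u, v} U) (E : Finset U) (M : Matroid U) (f : Finset U → ℝ)
  (π : Fin E.card ≃ E)

theorem output_subset (ω : A.Seed E.card) : A.output E M f π ω ⊆ E := by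
  intro x hx
  obtain ⟨i, -, rfl⟩ := (mem_output A E M f π).1 hx
  exact (π i).2

theorem measurableSet_output (P : Finset U → Prop) :
    MeasurableSet {ω | P (A.output E M f π ω)} :=
  measurableSet_of_finite_family (ι := Fin E.card)
    (B := fun i ω => A.accepts E.card ω
      (observe M f ((List.ofFn fun j => (π j : U)).take (i.val + 1))))
    (fun _ => A.measurable_accepts _ _)
    fun q => P ((Finset.univ.filter fun i => q i).image fun i => (π i : U))

theorem measurable_output (G : Finset U → ℝ) : Measurable fun ω => G (A.output E M f π ω) :=
  fun B _ => A.measurableSet_output E M f π fun S => G S ∈ B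

theorem integral_output (G : Finset U → ℝ) :
    ∫ ω, G (A.output E M f π ω) ∂(A.law E.card) =
      ∑ S ∈ E.powerset, G S * (A.law E.card).real {ω | A.output E M f π ω = S} := by
  have h : ∀ ω, G (A.output E M f π ω) =
      ∑ S ∈ E.powerset, Set.indicator {ω | A.output E M f π ω = S} (fun _ => G S) ω := by
    intro ω
    rw [Finset.sum_eq_single_of_mem _ (Finset.mem_powerset.2 (A.output_subset E M f π ω))]
    · simp
    · intro S _ hS
      simp [hS.symm]
  simp only [h]
  rw [integral_finsetSum]
  · refine Finset.sum_congr rfl fun S _ => ?_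
    rw [integral_indicator_const _ (A.measurableSet_output E M f π (· = S)), smul_eq_mul, mul_comm]
  · intro S _
    exact (integrable_const _).indicator (A.measurableSet_output E M f π (· = S))

theorem card_orders_pos : (0 : ℝ) < (Fintype.card (Fin E.card ≃ E) : ℝ) := by
  have : Nonempty (Fin E.card ≃ E) := ⟨E.equivFin.symm⟩
  exact_mod_cast Fintype.card_pos

theorem average_output (G : Finset U → ℝ) :
    (∑ π : Fin E.card ≃ E, ∫ ω, G (A.output E M f π ω) ∂(A.law E.card)) /
        (Fintype.card (Fin E.card ≃ E) : ℝ) =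
      ∑ S ∈ E.powerset, G S * A.outputProb E M f (fun Q => Q = S) := by
  simp only [integral_output, outputProb]
  rw [Finset.sum_comm, Finset.sum_div]
  refine Finset.sum_congr rfl fun S _ => ?_
  rw [← Finset.mul_sum, mul_div_assoc]

theorem outputProb_nonneg (P : Finset U → Prop) : 0 ≤ A.outputProb E M f P :=
  div_nonneg (Finset.sum_nonneg fun _ _ => measureReal_nonneg) (Nat.cast_nonneg _)

theorem outputProb_eq_sum (P : Finset U → Prop) :
    A.outputProb E M f P =
      ∑ S ∈ E.powerset, (if P S then 1 else 0) * A.outputProb E M f (fun Q => Q = S) := by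
  rw [← average_output, outputProb]
  congr 1
  refine Finset.sum_congr rfl fun π _ => ?_
  have : (fun ω => if P (A.output E M f π ω) then (1 : ℝ) else 0) =
      Set.indicator {ω | P (A.output E M f π ω)} fun _ => 1 := by
    funext ω; simp [Set.indicator]
  rw [this, integral_indicator_const _ (A.measurableSet_output E M f π P), smul_eq_mul, mul_one]

theorem outputProb_true : A.outputProb E M f (fun _ => True) = 1 := by
  simp only [outputProb, Set.ofPred_true, probReal_univ, Finset.sum_const, nsmul_eq_mul, mul_one]
  exact div_self (card_orders_pos E).ne'

theorem sum_outputProb : ∑ S ∈ E.powerset, A.outputProb E M f (fun Q => Q = S) = 1 := by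
  rw [← A.outputProb_true E M f, outputProb_eq_sum A E M f fun _ => True]
  simp

theorem outputProb_le_one (P : Finset U → Prop) : A.outputProb E M f P ≤ 1 := by
  rw [outputProb_eq_sum]
  refine (Finset.sum_le_sum fun S _ => ?_).trans_eq (A.sum_outputProb E M f)
  have := A.outputProb_nonneg E M f (fun Q => Q = S)
  split_ifs <;> linarith

/-- A property of all possible outputs holds almost surely, for every arrival order. -/
theorem ae_output_of_outputProb (P : Finset U → Prop)
    (hP : ∀ S, A.outputProb E M f (fun Q => Q = S) ≠ 0 → P S) :
    ∀ᵐ ω ∂(A.law E.card), P (A.output E M f π ω) := by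
  have hall : ∀ᵐ ω ∂(A.law E.card), ∀ S ∈ E.powerset, ¬ P S → A.output E M f π ω ≠ S := by
    rw [Filter.eventually_all_finset]
    intro S _
    by_cases hS : P S
    · exact Filter.Eventually.of_forall fun _ h => absurd hS h
    · have h0 : A.outputProb E M f (fun Q => Q = S) = 0 := by
        by_contra h; exact hS (hP S h)
      rw [outputProb, div_eq_zero_iff, or_iff_left (card_orders_pos E).ne',
        Finset.sum_eq_zero_iff_of_nonneg fun _ _ => measureReal_nonneg] at h0
      have h1 := (measureReal_eq_zero_iff).1 (h0 π (Finset.mem_univ _))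
      have h2 : ∀ᵐ ω ∂(A.law E.card), A.output E M f π ω ≠ S := by
        rw [ae_iff]; simpa using h1
      exact h2.mono fun _ h _ => h
  filter_upwards [hall] with ω hω
  by_contra h
  exact hω _ (Finset.mem_powerset.2 (A.output_subset E M f π ω)) h rfl

/-- Only subsets of `E` are ever queried with a nontrivial answer, so `f` may be altered outside
`E`. -/
theorem output_congr {f f' : Finset U → ℝ} (h : ∀ S ⊆ E, f S = f' S) (ω : A.Seed E.card) :
    A.output E M f π ω = A.output E M f' π ω := by
  have hobs : ∀ i : Fin E.card, observe M f ((List.ofFn fun j => (π j : U)).take (i.val + 1)) =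
      observe M f' ((List.ofFn fun j => (π j : U)).take (i.val + 1)) := by
    intro i
    simp only [observe, View.mk.injEq, and_true, true_and]
    funext S
    split_ifs with hS
    · refine h S fun x hx => ?_
      obtain ⟨j, -, rfl⟩ := mem_take_ofFn.1 (List.mem_toFinset.1 (hS hx))
      exact (π j).2
    · rfl
  ext x
  simp only [mem_output, hobs]

theorem expectedValue_congr {f f' : Finset U → ℝ} (h : ∀ S ⊆ E, f S = f' S) :
    A.expectedValue E M f = A.expectedValue E M f' := by
  simp only [expectedValue, A.output_congr E M _ h]
  congr 1
  refine Finset.sum_congr rfl fun π _ => integral_congr_ae (Filter.Eventually.of_forall fun ω => ?_)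
  exact h _ (A.output_subset E M f' π ω)

end OnlineAlgorithm

end OutputDistribution

/-! ### The reduction and its exact expected value. -/

section Reduction

open Classical MeasureTheory

variable {U : Type u}

theorem prod_labelProb_nonneg {ι : Type*} [Fintype ι] {p : ℝ} (h0 : 0 ≤ p) (h1 : p ≤ 1)
    (e : ι → Fin 3) : 0 ≤ ∏ x, labelProb p (e x) :=
  Finset.prod_nonneg fun _ _ => labelProb_nonneg h0 h1 _

namespace OnlineAlgorithm

/-- The algorithm that draws random labels, rejects the elements of label `0` on arrival, runs
`A` with the weights determined by the labels, and accepts the elements of label `1` that `A`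
accepts. -/
noncomputable abbrev reduction (A : OnlineAlgorithm.{u, v} U) {p : ℝ} (h0 : 0 ≤ p) (h1 : p ≤ 1) :
    OnlineAlgorithm.{u, v} U where
  Seed n := (Fin n → Fin 3) × A.Seed n
  seedSpace _ := inferInstance
  law n := ∑ s : Fin n → Fin 3,
    ENNReal.ofReal (∏ j, labelProb p (s j)) • (A.law n).map (Prod.mk s)
  law_prob n := by
    constructor
    have hmap : ∀ s : Fin n → Fin 3, (A.law n).map (Prod.mk s) Set.univ = 1 := fun s => by
      rw [Measure.map_apply measurable_prodMk_left MeasurableSet.univ]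
      simp
    simp only [Measure.finsetSum_apply, Measure.smul_apply, hmap, smul_eq_mul, mul_one]
    rw [← ENNReal.ofReal_sum_of_nonneg fun s _ => prod_labelProb_nonneg h0 h1 s,
      ← ENNReal.ofReal_one]
    congr 1
    simpa [labelExp] using labelExp_const (ι := Fin n) (p := p) 1
  -- The current arrival time `i` is recovered from the number of arrivals.
  accepts n ω V := ∃ i : Fin n, V.arrived.length = i.val + 1 ∧
    ω.1 (simulationOrder ω.1 i) = 1 ∧ A.accepts n ω.2 (simulatedView ω.1 V i)
  measurable_accepts n V := by
    have : {ω : (Fin n → Fin 3) × A.Seed n | ∃ i : Fin n, V.arrived.length = i.val + 1 ∧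
        ω.1 (simulationOrder ω.1 i) = 1 ∧ A.accepts n ω.2 (simulatedView ω.1 V i)} =
        ⋃ (s : Fin n → Fin 3) (i : Fin n), {s} ×ˢ {ω | V.arrived.length = i.val + 1 ∧
          s (simulationOrder s i) = 1 ∧ A.accepts n ω (simulatedView s V i)} := by
      ext ⟨s, ω⟩
      simp
    rw [this]
    refine MeasurableSet.iUnion fun s => MeasurableSet.iUnion fun i =>
      (measurableSet_singleton s).prod ?_
    exact (MeasurableSet.const _).inter
      ((MeasurableSet.const _).inter (A.measurable_accepts n _))

variable (A : OnlineAlgorithm.{u, v} U) {p : ℝ} (h0 : 0 ≤ p) (h1 : p ≤ 1)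
  (E : Finset U) (M : Matroid U) (f : Finset U → ℝ)

/-- At positions of label 1 the simulated view is exactly the view of `A` on the linear instance.
Decisions of `A` at other positions are not needed, because their elements are filtered out. -/
theorem output_reduction (π : Fin E.card ≃ E) (s : Fin E.card → Fin 3) (ω : A.Seed E.card) :
    (A.reduction h0 h1).output E M f π (s, ω) =
      (A.output E M
        (fun S => ∑ x ∈ S,
          linearWeight E M f (extendLabel E (s ∘ ((simulationOrder s).symm.trans π).symm)) x)
        ((simulationOrder s).symm.trans π) ω).filter
        (fun x => extendLabel E (s ∘ ((simulationOrder s).symm.trans π).symm) x = 1) := by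
  ext x
  rw [Finset.mem_filter, mem_output, mem_output]
  constructor
  · rintro ⟨i, ⟨i', hlen, hi1, hacc⟩, rfl⟩
    have hii : i' = i := by
      simp only [observe, List.length_take, List.length_ofFn] at hlen
      have := i.2
      exact Fin.ext (by omega)
    subst hii
    rw [simulatedView_observe (by rw [hi1]; simp)] at hacc
    refine ⟨⟨simulationOrder s i', hacc, by simp⟩, ?_⟩
    have := extendLabel_comp_symm s ((simulationOrder s).symm.trans π) (simulationOrder s i')
    simp only [Equiv.trans_apply, Equiv.symm_apply_apply] at this
    exact this.trans hi1
  · rintro ⟨⟨j, hacc, rfl⟩, h1j⟩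
    rw [extendLabel_comp_symm] at h1j
    have hj : simulationOrder s ((simulationOrder s).symm j) = j := by simp
    refine ⟨(simulationOrder s).symm j, ⟨(simulationOrder s).symm j, ?_, ?_, ?_⟩, rfl⟩
    · simp only [observe, List.length_take, List.length_ofFn]
      have := ((simulationOrder s).symm j).2
      omega
    · rw [hj]; exact h1j
    · rw [simulatedView_observe (by rw [hj]; exact ne_of_eq_of_ne h1j one_ne_zero), hj]
      exact hacc

theorem integral_law_reduction {G : (Fin E.card → Fin 3) × A.Seed E.card → ℝ}
    (hG : Measurable G) {C : ℝ} (hC : ∀ ω, ‖G ω‖ ≤ C) :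
    ∫ ω, G ω ∂((A.reduction h0 h1).law E.card) =
      labelExp p fun s : Fin E.card → Fin 3 => ∫ ω, G (s, ω) ∂(A.law E.card) := by
  have hprob : ∀ s : Fin E.card → Fin 3,
      IsProbabilityMeasure ((A.law E.card).map (Prod.mk s)) := fun s =>
    Measure.isProbabilityMeasure_map measurable_prodMk_left.aemeasurable
  rw [integral_finsetSum_measure]
  · refine Finset.sum_congr rfl fun s _ => ?_
    rw [integral_smul_measure, ENNReal.toReal_ofReal (prod_labelProb_nonneg h0 h1 s),
      integral_map measurable_prodMk_left.aemeasurable hG.aestronglyMeasurable, smul_eq_mul]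
  · intro s _
    refine Integrable.smul_measure ?_ ENNReal.ofReal_ne_top
    exact Integrable.of_bound hG.aestronglyMeasurable C (Filter.Eventually.of_forall hC)

/-- The expected value of the guarded reduction in terms of the output distribution of `A` on the
linear instances that belong to random labels. -/
theorem expectedValue_guarded_reduction
    (hfeas : ∀ (e : E → Fin 3) S, A.outputProb E M
      (fun S => ∑ x ∈ S, linearWeight E M f (extendLabel E e) x) (fun Q => Q = S) ≠ 0 →
      M.Indep (S : Set U)) :
    (A.reduction h0 h1).guarded.expectedValue E M f =
      labelExp p fun e : E → Fin 3 => ∑ S ∈ E.powerset,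
        f (S.filter fun x => extendLabel E e x = 1) * A.outputProb E M
          (fun S => ∑ x ∈ S, linearWeight E M f (extendLabel E e) x) (fun Q => Q = S) := by
  set Φ : (E → Fin 3) → (Fin E.card ≃ E) → ℝ := fun e π => ∫ ω, f ((A.output E M
    (fun S => ∑ x ∈ S, linearWeight E M f (extendLabel E e) x) π ω).filter
      fun x => extendLabel E e x = 1) ∂(A.law E.card) with hΦ
  have hint : ∀ π : Fin E.card ≃ E,
      ∫ ω, f ((A.reduction h0 h1).guarded.output E M f π ω)
        ∂((A.reduction h0 h1).guarded.law E.card) =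
      labelExp p fun s : Fin E.card → Fin 3 =>
        Φ (s ∘ ((simulationOrder s).symm.trans π).symm) ((simulationOrder s).symm.trans π) := by
    intro π
    rw [A.integral_law_reduction h0 h1 E
      ((A.reduction h0 h1).guarded.measurable_output E M f π f)
      -- A crude bound, used only for integrability.
      (C := ∑ S ∈ E.powerset, |f S|)]
    · refine congrArg _ (funext fun s => integral_congr_ae ?_)
      -- Outputs of probability 0 may be dependent, so the guard is idle only almost surely.
      filter_upwards [A.ae_output_of_outputProb E M _ ((simulationOrder s).symm.trans π)
        (fun S => M.Indep (S : Set U))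
        (hfeas (s ∘ ((simulationOrder s).symm.trans π).symm))] with ω hω
      have hind : M.Indep ((A.reduction h0 h1).output E M f π (s, ω) : Set U) := by
        rw [output_reduction]
        exact hω.subset (Finset.coe_subset.2 (Finset.filter_subset _ _))
      have := (A.reduction h0 h1).output_guarded_eq E M f π hind
      rw [output_reduction] at this
      exact congrArg f this
    · intro ω
      exact Finset.single_le_sum (f := fun S => |f S|) (fun _ _ => abs_nonneg _)
        (Finset.mem_powerset.2 ((A.reduction h0 h1).guarded.output_subset E M f π ω))
  have hsum : ∑ π : Fin E.card ≃ E, (labelExp p fun s : Fin E.card → Fin 3 =>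
        Φ (s ∘ ((simulationOrder s).symm.trans π).symm) ((simulationOrder s).symm.trans π)) =
      labelExp p fun e => ∑ π, Φ e π := by
    calc _ = labelExp p fun s : Fin E.card → Fin 3 => ∑ π : Fin E.card ≃ E,
          Φ (s ∘ ((simulationOrder s).symm.trans π).symm) ((simulationOrder s).symm.trans π) := by
          simp only [labelExp, Finset.mul_sum]
          rw [Finset.sum_comm]
      _ = labelExp p fun s : Fin E.card → Fin 3 => ∑ π : Fin E.card ≃ E, Φ (s ∘ π.symm) π := by
          refine congrArg _ (funext fun s => ?_)
          -- For fixed position labels, passing from the real to the simulated order permutes the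
          -- set of orders.
          exact Fintype.sum_equiv (Equiv.equivCongr (simulationOrder s) (Equiv.refl _)) _ _
            fun π => rfl
      _ = ∑ π : Fin E.card ≃ E, labelExp p fun s : Fin E.card → Fin 3 => Φ (s ∘ π.symm) π := by
          simp only [labelExp, Finset.mul_sum]
          rw [Finset.sum_comm]
      _ = ∑ π : Fin E.card ≃ E, labelExp p fun e => Φ e π :=
          -- For a fixed order, independent position labels become independent element labels with
          -- the same law.
          Finset.sum_congr rfl fun π _ => labelExp_comp_equiv π fun e => Φ e π
      _ = _ := by
          simp only [labelExp, Finset.mul_sum]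
          rw [Finset.sum_comm]
  rw [expectedValue, Finset.sum_congr rfl fun π _ => hint π, hsum, div_eq_inv_mul,
    ← labelExp_const_mul]
  refine congrArg _ (funext fun e => ?_)
  rw [← A.average_output E M _ fun S => f (S.filter fun x => extendLabel E e x = 1),
    div_eq_inv_mul]

end OnlineAlgorithm

end Reduction

/-! ### From the three inequalities to the competitive ratios. -/

section Competitiveness

open Classical

variable {U : Type u}

/-- Passing to S ↦ f(S ∩ E) makes the inequalities global and frees the greedy analysis from side
conditions about `E`. -/
theorem IsMonotoneSubmodularObjective.restrict {E : Finset U} {f : Finset U → ℝ}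
    (h : IsMonotoneSubmodularObjective E f) :
    (∀ S, 0 ≤ f (S ∩ E)) ∧ Monotone (fun S => f (S ∩ E)) ∧
      ∀ A B, A ⊆ B → ∀ x,
        marginal (fun S => f (S ∩ E)) B x ≤ marginal (fun S => f (S ∩ E)) A x := by
  obtain ⟨hnonneg, hmono, hsub⟩ := h
  have hm : Monotone (fun S => f (S ∩ E)) := fun S T hST =>
    hmono _ _ (Finset.inter_subset_inter_right hST) Finset.inter_subset_right
  refine ⟨fun S => hnonneg _ Finset.inter_subset_right, hm, fun A B hAB x => ?_⟩
  have hA : 0 ≤ marginal (fun S => f (S ∩ E)) A x := sub_nonneg.2 (hm (Finset.subset_insert _ _))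
  by_cases hx : x ∈ E \ (B ∩ E)
  · have hxE := (Finset.mem_sdiff.1 hx).1
    simp only [marginal, Finset.insert_inter_of_mem hxE]
    exact hsub _ _ (Finset.inter_subset_inter_right hAB) Finset.inter_subset_right x hx
  · refine le_trans (le_of_eq ?_) hA
    have : insert x B ∩ E = B ∩ E := by
      by_cases hxE : x ∈ E
      · have hxB : x ∈ B := by
          by_contra hxB
          exact hx (Finset.mem_sdiff.2 ⟨hxE, fun h => hxB (Finset.mem_inter.1 h).1⟩)
        rw [Finset.insert_eq_of_mem hxB]
      · rw [Finset.insert_inter_of_notMem hxE]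
    simp [marginal, this]

theorem le_add_of_submodular {f : Finset U → ℝ} (hnonneg : ∀ S, 0 ≤ f S)
    (hsub : ∀ A B, A ⊆ B → ∀ x, marginal f B x ≤ marginal f A x) (A B : Finset U) :
    f (A ∪ B) ≤ f A + f B := by
  induction B using Finset.induction_on with
  | empty => simpa using hnonneg ∅
  | insert x B _ ih =>
    have := hsub B (A ∪ B) Finset.subset_union_right x
    rw [marginal, marginal, ← Finset.union_insert] at this
    linarith

theorem biUnion_le_sum_of_submodular {f : Finset U → ℝ} (hnonneg : ∀ S, 0 ≤ f S)
    (hsub : ∀ A B, A ⊆ B → ∀ x, marginal f B x ≤ marginal f A x) {ι : Type*} {s : Finset ι}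
    (hs : s.Nonempty) (P : ι → Finset U) : f (s.biUnion P) ≤ ∑ i ∈ s, f (P i) := by
  induction hs using Finset.Nonempty.cons_induction with
  | singleton i => simp
  | cons i s hi _ ih =>
    rw [Finset.cons_eq_insert, Finset.biUnion_insert, Finset.sum_insert hi]
    exact (le_add_of_submodular hnonneg hsub _ _).trans (by gcongr)

variable {E : Finset U} {M : Matroid U} {f : Finset U → ℝ}

theorem isLinearObjective_linearWeight (hmono : Monotone f) (t : U → Fin 3) :
    IsLinearObjective E fun S => ∑ x ∈ S, linearWeight E M f t x := by
  refine ⟨linearWeight E M f t, fun x _ => ?_, fun _ _ => rfl⟩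
  rw [linearWeight]
  split_ifs
  exacts [greedyWeight_nonneg hmono _ _ _ _, le_rfl]

theorem sum_linearWeight (t : U → Fin 3) (S : Finset U) :
    ∑ x ∈ S, linearWeight E M f t x = ∑ x ∈ S.filter (fun x => t x = 1),
      greedyWeight (fun S => M.Indep (S : Set U)) f t ∅ E x := by
  simp only [linearWeight, Finset.sum_filter]

/-- `δ` bounds the loss of the value of the elements of label `1` against their weight. -/
def IsLossBound (E : Finset U) (M : Matroid U) (f : Finset U → ℝ) (t : U → Fin 3)
    (δ : U → ℝ) : Prop :=
  (∀ x, 0 ≤ δ x) ∧ ∀ X ⊆ E, (∀ x ∈ X, t x = 1) →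
    f ∅ + ∑ x ∈ X, (greedyWeight (fun S => M.Indep (S : Set U)) f t ∅ E x - δ x) ≤ f X

/-- Elements of labels other than 1 have weight 0, so filtering them out of `S` loses no weight. -/
theorem IsLossBound.le {t : U → Fin 3} {δ : U → ℝ} (h : IsLossBound E M f t δ)
    {S : Finset U} (hS : S ⊆ E) :
    f ∅ + ∑ x ∈ S, linearWeight E M f t x - ∑ x ∈ S.filter (fun x => t x = 1), δ x ≤
      f (S.filter fun x => t x = 1) := by
  have := h.2 (S.filter fun x => t x = 1) ((Finset.filter_subset _ _).trans hS)
    (fun x hx => (Finset.mem_filter.1 hx).2)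
  rw [Finset.sum_sub_distrib] at this
  rw [sum_linearWeight]
  linarith

namespace OnlineAlgorithm

/-- If, for all labels, the linear algorithm provides enough value, then the guarded reduction is
competitive. -/
theorem le_expectedValue_guarded_reduction (A : OnlineAlgorithm.{u, v} U) {α q κ p : ℝ}
    (hα : 1 ≤ α) (hq : 0 ≤ q) (hκ : 0 ≤ κ) (hp : p = 1 / (2 * (α * q + 1)))
    (h0 : 0 ≤ p) (h1 : p ≤ 1)
    (hnonneg : ∀ S, 0 ≤ f S) (hmono : Monotone f)
    (hsub : ∀ A B, A ⊆ B → ∀ x, marginal f B x ≤ marginal f A x)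
    (hfeas : ∀ (t : U → Fin 3) S, A.outputProb E M
      (fun S => ∑ x ∈ S, linearWeight E M f t x) (fun Q => Q = S) ≠ 0 → M.Indep (S : Set U))
    (hval : ∀ (t : U → Fin 3) (I : Finset U), M.Indep (I : Set U) →
      ∀ δ, IsLossBound E M f t δ →
        κ * (f ∅ + (∑ x ∈ I, linearWeight E M f t x) / α - q * ∑ x ∈ E, δ x) ≤
          ∑ S ∈ E.powerset, f (S.filter fun x => t x = 1) * A.outputProb E M
            (fun S => ∑ x ∈ S, linearWeight E M f t x) (fun Q => Q = S))
    {O : Finset U} (hOE : O ⊆ E) (hO : M.Indep (O : Set U)) :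
    κ * (f O / (8 * α * (α * q + 1))) ≤ (A.reduction h0 h1).guarded.expectedValue E M f := by
  rw [A.expectedValue_guarded_reduction h0 h1 E M f fun e => hfeas _]
  set S₀ : GreedyState U := ⟨∅, ∅, ∅⟩
  set EG := expectedTotal (fun T => M.Indep (T : Set U)) f E p (growthReward f) S₀ E with hEG
  set EJ := expectedTotal (fun T => M.Indep (T : Set U)) f E p
    (chosenReward (fun T => M.Indep (T : Set U)) f) S₀ E with hEJ
  set ED := expectedTotal (fun T => M.Indep (T : Set U)) f E p (lossReward f) S₀ E with hED
  have hlow : κ * (f ∅ + EJ / α - q * ED) ≤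
      labelExp p fun e : E → Fin 3 => ∑ S ∈ E.powerset,
        f (S.filter fun x => extendLabel E e x = 1) * A.outputProb E M
          (fun S => ∑ x ∈ S, linearWeight E M f (extendLabel E e) x) (fun Q => Q = S) := by
    have : κ * (f ∅ + EJ / α - q * ED) = labelExp p fun e : E → Fin 3 => κ * (f ∅ +
        α⁻¹ * greedyTotal (fun T => M.Indep (T : Set U)) f
          (chosenReward (fun T => M.Indep (T : Set U)) f) (extendLabel E e) S₀ E -
        q * greedyTotal (fun T => M.Indep (T : Set U)) f (lossReward f)
          (extendLabel E e) S₀ E) := by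
      rw [labelExp_const_mul, labelExp_sub, labelExp_add, labelExp_const, labelExp_const_mul,
        labelExp_const_mul, div_eq_inv_mul]
      rfl
    rw [this]
    refine labelExp_mono h0 h1 fun e => ?_
    obtain ⟨I, hIE, hI1, hI, hsum⟩ := exists_chosen (f := f)
      (ind := fun T => M.Indep (T : Set U)) (extendLabel E e) S₀ E (by simp [S₀])
    obtain ⟨δ, hδ, hδsum, hδval⟩ := exists_loss (ind := fun T => M.Indep (T : Set U)) hmono hsub
      (extendLabel E e) S₀ E
    have key := hval (extendLabel E e) I (by simpa [S₀] using hI) δ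
      ⟨hδ, fun X hX hX1 => by simpa [S₀] using hδval ∅ (by simp) X hX hX1⟩
    rw [sum_linearWeight, Finset.filter_true_of_mem hI1, hδsum] at key
    rw [hsum, ← div_eq_inv_mul]
    exact key
  refine le_trans (mul_le_mul_of_nonneg_left ?_ hκ) hlow
  have ineqD := expectedTotal_loss_le (ind := fun T => M.Indep (T : Set U)) hmono h0 h1 S₀
    (subset_refl E)
  have ineqG := le_expectedTotal_growth hmono hsub h0 h1 S₀ (subset_refl E) (by simp [S₀]) hOE
    (by simpa [S₀] using hO)
  -- Initially `k = 0`, so the term with `g` vanishes and any upper bound on the marginals will do.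
  have ineqJ := le_expectedTotal_chosen (M := M) hmono hsub h0 h1 S₀ (subset_refl E) (by simp [S₀])
    (by simp [S₀]) (k := 0) (by simp [S₀]) (g := ∑ y ∈ E, |marginal f ∅ y|)
    (fun y hy => (le_abs_self _).trans (Finset.single_le_sum (f := fun y => |marginal f ∅ y|)
      (fun _ _ => abs_nonneg _) (Finset.mem_filter.1 hy).1))
    (Finset.sum_nonneg fun _ _ => abs_nonneg _)
  have ineq0 := expectedTotal_growth_nonneg (ind := fun T => M.Indep (T : Set U)) hmono h0 h1 S₀
    (subset_refl E)
  rw [← hEG] at ineqD ineqG ineqJ ineq0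
  rw [← hED] at ineqD
  rw [← hEJ] at ineqJ
  simp only [S₀, Finset.empty_union, Nat.cast_zero, mul_zero, add_zero] at ineqD ineqG ineqJ
  have hf0 := hnonneg ∅
  clear_value EG EJ ED
  have ht : 0 ≤ α * q := by positivity
  set t := α * q with ht_def
  have hα0 : 0 < α := by linarith
  -- Since 1/p = 2(t + 1), the two factors are (1 + p)/p = 2t + 3 and (1 + p)/p² = (2t + 3)·2(t +
  -- 1).
  have hJ : EG ≤ (2 * t + 3) * EJ := by
    rw [hp] at ineqJ
    field_simp at ineqJ
    linarith
  have hD : (2 * t + 3) * (2 * (t + 1)) * ED ≤ EG := by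
    have h2 : (1 + p) * ED ≤ p * p * EG := by linarith
    rw [hp] at h2
    field_simp at h2
    linarith
  rw [div_le_iff₀ (by positivity)]
  have hexpand : (f ∅ + EJ / α - q * ED) * (8 * α * (t + 1)) =
      8 * α * (t + 1) * f ∅ + 8 * (t + 1) * EJ - 8 * t * (t + 1) * ED := by
    rw [ht_def]; field_simp
  rw [hexpand]
  have hs : 0 < 2 * t + 3 := by linarith
  -- After multiplication by 2t + 3 this amounts to 8(t + 1) - 4t ≥ 2(2t + 3).
  have h3 : 2 * EG ≤ 8 * (t + 1) * EJ - 8 * t * (t + 1) * ED := by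
    have e1 : (8 * (t + 1)) * EG ≤ (8 * (t + 1)) * ((2 * t + 3) * EJ) :=
      mul_le_mul_of_nonneg_left hJ (by linarith)
    have e2 : (4 * t) * ((2 * t + 3) * (2 * (t + 1)) * ED) ≤ (4 * t) * EG :=
      mul_le_mul_of_nonneg_left hD (by linarith)
    refine le_of_mul_le_mul_left ?_ hs
    nlinarith
  have h4 : f ∅ ≤ 8 * α * (t + 1) * f ∅ := by
    refine le_mul_of_one_le_left hf0 ?_
    nlinarith
  linarith

/-- The value of the elements of label `1` selected by a competitive linear algorithm that selects
every element with probability at most `q`. -/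
theorem sum_ge_of_competitiveOn (A : OnlineAlgorithm.{u, v} U) {α q : ℝ}
    (hmono : Monotone f) (hA : A.CompetitiveOn IsLinearObjective E M α)
    (hq : A.SelectsWithProbAtMost E M q) (t : U → Fin 3) {I : Finset U}
    (hI : M.Indep (I : Set U)) {δ : U → ℝ} (hδ : IsLossBound E M f t δ) :
    f ∅ + (∑ x ∈ I, linearWeight E M f t x) / α - q * ∑ x ∈ E, δ x ≤
      ∑ S ∈ E.powerset, f (S.filter fun x => t x = 1) * A.outputProb E M
        (fun S => ∑ x ∈ S, linearWeight E M f t x) (fun Q => Q = S) := by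
  set g : Finset U → ℝ := fun S => ∑ x ∈ S, linearWeight E M f t x with hg
  have hlin : IsLinearObjective E g := isLinearObjective_linearWeight hmono t
  have hcomp := hA.2 g hlin I hI
  rw [expectedValue, A.average_output E M g g] at hcomp
  have hloss : ∑ S ∈ E.powerset, (∑ x ∈ S.filter (fun x => t x = 1), δ x) *
      A.outputProb E M g (fun Q => Q = S) ≤ q * ∑ x ∈ E, δ x := by
    calc _ ≤ ∑ S ∈ E.powerset, ∑ x ∈ E, δ x * ((if x ∈ S then 1 else 0) *
          A.outputProb E M g (fun Q => Q = S)) := by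
          refine Finset.sum_le_sum fun S hS => ?_
          have h1 : ∑ x ∈ S.filter (fun x => t x = 1), δ x ≤
              ∑ x ∈ E, δ x * (if x ∈ S then 1 else 0) := by
            rw [← Finset.sum_subset (Finset.mem_powerset.1 hS)
              (f := fun x => δ x * (if x ∈ S then 1 else 0)) (fun x _ hx => by simp [hx])]
            refine (Finset.sum_le_sum_of_subset_of_nonneg (Finset.filter_subset _ _)
              fun x _ _ => hδ.1 x).trans (Finset.sum_le_sum fun x hx => by simp [hx])
          refine (mul_le_mul_of_nonneg_right h1 (A.outputProb_nonneg E M g _)).trans_eq ?_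
          rw [Finset.sum_mul]
          exact Finset.sum_congr rfl fun x _ => by ring
      _ = ∑ x ∈ E, δ x * A.outputProb E M g (fun Q => x ∈ Q) := by
          rw [Finset.sum_comm]
          refine Finset.sum_congr rfl fun x _ => ?_
          rw [← Finset.mul_sum, outputProb_eq_sum A E M g fun Q => x ∈ Q]
          congr!
      _ ≤ ∑ x ∈ E, δ x * q := Finset.sum_le_sum fun x hx =>
          mul_le_mul_of_nonneg_left (hq g hlin x hx) (hδ.1 x)
      _ = q * ∑ x ∈ E, δ x := by rw [← Finset.sum_mul, mul_comm]
  have hmain : ∑ S ∈ E.powerset, (f ∅ + g S - ∑ x ∈ S.filter (fun x => t x = 1), δ x) *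
      A.outputProb E M g (fun Q => Q = S) ≤
      ∑ S ∈ E.powerset, f (S.filter fun x => t x = 1) *
        A.outputProb E M g (fun Q => Q = S) :=
    Finset.sum_le_sum fun S hS => mul_le_mul_of_nonneg_right
      (hδ.le (Finset.mem_powerset.1 hS)) (A.outputProb_nonneg E M g _)
  simp only [sub_mul, add_mul, Finset.sum_sub_distrib, Finset.sum_add_distrib,
    ← Finset.mul_sum, sum_outputProb, mul_one] at hmain
  have hgI : g I = ∑ x ∈ I, linearWeight E M f t x := rfl
  rw [← hgI]
  linarith

theorem sum_outputProb_of_isUniformAmong (A : OnlineAlgorithm.{u, v} U) {k : ℕ}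
    {g : Finset U → ℝ} {μ : PMF (Fin k → E.powerset)}
    (hμ : ∀ S : Finset U, A.outputProb E M g (fun Q => Q = S) =
      (∑ i : Fin k, ∑ P : Fin k → E.powerset,
        if (P i : Finset U) = S then (μ P).toReal else 0) / k) (G : Finset U → ℝ) :
    ∑ S ∈ E.powerset, G S * A.outputProb E M g (fun Q => Q = S) =
      (∑ P : Fin k → E.powerset, (μ P).toReal * ∑ i, G (P i)) / k := by
  simp only [hμ]
  calc _ = (∑ S ∈ E.powerset, ∑ i : Fin k, ∑ P : Fin k → E.powerset,
        if (P i : Finset U) = S then G S * (μ P).toReal else 0) / k := by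
        rw [Finset.sum_div]
        refine Finset.sum_congr rfl fun S _ => ?_
        rw [← mul_div_assoc, Finset.mul_sum]
        simp only [Finset.mul_sum, mul_ite, mul_zero]
    _ = _ := by
        congr 1
        rw [Finset.sum_comm]
        simp only [Finset.mul_sum]
        rw [Finset.sum_comm (s := Finset.univ (α := Fin k → E.powerset))]
        refine Finset.sum_congr rfl fun i _ => ?_
        rw [Finset.sum_comm]
        refine Finset.sum_congr rfl fun P _ => ?_
        rw [Finset.sum_ite_eq, if_pos (P i).2, mul_comm]

/-- The value of the elements of label `1` selected by a linear algorithm whose output is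
distributed uniformly among `k` sets with a large union. -/
theorem sum_ge_of_isUniformAmong (A : OnlineAlgorithm.{u, v} U) {α : ℝ} {k : ℕ} (hk : 1 ≤ k)
    (hnonneg : ∀ S, 0 ≤ f S) (hmono : Monotone f)
    (hsub : ∀ A B, A ⊆ B → ∀ x, marginal f B x ≤ marginal f A x)
    (hA : A.IsUniformAmong E M k α) (t : U → Fin 3) {I : Finset U}
    (hI : M.Indep (I : Set U)) {δ : U → ℝ} (hδ : IsLossBound E M f t δ) :
    1 / (k : ℝ) * (f ∅ + (∑ x ∈ I, linearWeight E M f t x) / α - 1 * ∑ x ∈ E, δ x) ≤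
      ∑ S ∈ E.powerset, f (S.filter fun x => t x = 1) * A.outputProb E M
        (fun S => ∑ x ∈ S, linearWeight E M f t x) (fun Q => Q = S) := by
  set g : Finset U → ℝ := fun S => ∑ x ∈ S, linearWeight E M f t x with hg
  obtain ⟨μ, -, hval, hprob⟩ := hA g (isLinearObjective_linearWeight hmono t)
  rw [A.sum_outputProb_of_isUniformAmong hprob fun S => f (S.filter fun x => t x = 1),
    one_div_mul_eq_div]
  refine div_le_div_of_nonneg_right ?_ (Nat.cast_nonneg k)
  have hμ1 : ∑ P : Fin k → E.powerset, (μ P).toReal = 1 := by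
    have h := μ.tsum_coe
    rw [tsum_fintype] at h
    rw [← ENNReal.toReal_sum fun P _ => μ.apply_ne_top P, h, ENNReal.toReal_one]
  have hne : (Finset.univ : Finset (Fin k)).Nonempty := ⟨⟨0, hk⟩, Finset.mem_univ _⟩
  have hP : ∀ P : Fin k → E.powerset,
      f ∅ + g (Finset.univ.biUnion fun i => (P i : Finset U)) - ∑ x ∈ E, δ x ≤
        ∑ i, f ((P i : Finset U).filter fun x => t x = 1) := by
    intro P
    have hsubE : (Finset.univ.biUnion fun i => (P i : Finset U)) ⊆ E :=
      Finset.biUnion_subset.2 fun i _ => Finset.mem_powerset.1 (P i).2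
    have h1 := hδ.le hsubE
    have h2 : ∑ x ∈ (Finset.univ.biUnion fun i => (P i : Finset U)).filter (fun x => t x = 1),
        δ x ≤ ∑ x ∈ E, δ x :=
      Finset.sum_le_sum_of_subset_of_nonneg ((Finset.filter_subset _ _).trans hsubE)
        fun x _ _ => hδ.1 x
    -- Comparing the parts with their union charges each `δ x` once, rather than once for every part
    -- containing `x`.
    have h3 := biUnion_le_sum_of_submodular hnonneg hsub hne
      fun i => (P i : Finset U).filter fun x => t x = 1
    rw [← Finset.filter_biUnion] at h3
    linarith
  have hsum := Finset.sum_le_sum fun P (_ : P ∈ Finset.univ) =>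
    mul_le_mul_of_nonneg_left (hP P) (ENNReal.toReal_nonneg (a := μ P))
  simp only [mul_sub, mul_add, Finset.sum_sub_distrib, Finset.sum_add_distrib,
    ← Finset.sum_mul, hμ1, one_mul] at hsum
  have := hval I hI
  have hgI : g I = ∑ x ∈ I, linearWeight E M f t x := rfl
  rw [← hgI]
  linarith

theorem indep_of_feasibleOn (A : OnlineAlgorithm.{u, v} U) {g : Finset U → ℝ}
    (hg : IsLinearObjective E g) (hA : A.FeasibleOn IsLinearObjective E M) {S : Finset U}
    (hS : A.outputProb E M g (fun Q => Q = S) ≠ 0) : M.Indep (S : Set U) := by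
  by_contra hdep
  refine hS ?_
  have hne : ∀ π ω, A.output E M g π ω ≠ S := fun π ω h => hdep (h ▸ hA g hg π ω)
  simp [outputProb, hne]

theorem indep_of_isUniformAmong (A : OnlineAlgorithm.{u, v} U) {g : Finset U → ℝ} {k : ℕ} {α : ℝ}
    (hg : IsLinearObjective E g) (hA : A.IsUniformAmong E M k α) {S : Finset U}
    (hS : A.outputProb E M g (fun Q => Q = S) ≠ 0) : M.Indep (S : Set U) := by
  obtain ⟨μ, hind, -, hprob⟩ := hA g hg
  by_contra hdep
  refine hS ?_
  rw [hprob]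
  refine div_eq_zero_iff.2
    (Or.inl (Finset.sum_eq_zero fun i _ => Finset.sum_eq_zero fun P _ => ?_))
  split_ifs with h
  · have : μ P = 0 := by
      rw [PMF.apply_eq_zero_iff]
      exact fun hP => hdep (h ▸ hind P hP i)
    simp [this]
  · rfl

theorem isAlgorithmFor_guarded (A : OnlineAlgorithm.{u, v} U)
    (C : Finset U → (Finset U → ℝ) → Prop) : A.guarded.IsAlgorithmFor C :=
  fun E M _ f _ π ω => A.indep_output_guarded E M f π ω

theorem competitiveOn_guarded_reduction (A : OnlineAlgorithm.{u, v} U) {p c : ℝ} (h0 : 0 ≤ p)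
    (h1 : p ≤ 1) (hME : M.E = (E : Set U))
    (h : ∀ f : Finset U → ℝ, (∀ S, 0 ≤ f S) → Monotone f →
      (∀ A B, A ⊆ B → ∀ x, marginal f B x ≤ marginal f A x) →
      ∀ O ⊆ E, M.Indep (O : Set U) →
        f O / c ≤ (A.reduction h0 h1).guarded.expectedValue E M f) :
    (A.reduction h0 h1).guarded.CompetitiveOn IsMonotoneSubmodularObjective E M c := by
  refine ⟨isAlgorithmFor_guarded _ _ E M hME, fun f hf O hO => ?_⟩
  have hOE : O ⊆ E := by
    have := hO.subset_ground
    rwa [hME, Finset.coe_subset] at this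
  obtain ⟨hnonneg, hmono, hsub⟩ := hf.restrict
  have key := h _ hnonneg hmono hsub O hOE hO
  rw [expectedValue_congr _ E M (f := f) (f' := fun S => f (S ∩ E))
    fun S hS => by rw [Finset.inter_eq_left.2 hS]]
  rwa [Finset.inter_eq_left.2 hOE] at key

theorem exists_competitive_of_selectsWithProbAtMost (A : OnlineAlgorithm.{u, v} U) {α q : ℝ}
    (hα : 1 ≤ α) (hq : 0 ≤ q) :
    ∃ B : OnlineAlgorithm.{u, v} U, B.IsAlgorithmFor IsMonotoneSubmodularObjective ∧
      ∀ (E : Finset U) (M : Matroid U), M.E = (E : Set U) →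
        A.CompetitiveOn IsLinearObjective E M α → A.SelectsWithProbAtMost E M q →
        B.CompetitiveOn IsMonotoneSubmodularObjective E M (8 * α * (α * q + 1)) := by
  have ht : 0 ≤ α * q := by positivity
  have h0 : 0 ≤ 1 / (2 * (α * q + 1)) := by positivity
  have h1 : 1 / (2 * (α * q + 1)) ≤ 1 := by
    rw [div_le_one (by positivity)]; linarith
  refine ⟨(A.reduction h0 h1).guarded, isAlgorithmFor_guarded _ _, fun E M hME hA hAq => ?_⟩
  refine A.competitiveOn_guarded_reduction h0 h1 hME fun f hnonneg hmono hsub O hOE hO => ?_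
  have := A.le_expectedValue_guarded_reduction (E := E) (M := M) hα hq zero_le_one rfl h0 h1
    hnonneg hmono hsub
    (fun t S => A.indep_of_feasibleOn (isLinearObjective_linearWeight hmono t) hA.1)
    (fun t I hI δ hδ => by
      rw [one_mul]; exact A.sum_ge_of_competitiveOn hmono hA hAq t hI hδ) hOE hO
  rwa [one_mul] at this

theorem exists_competitive_of_isUniformAmong (A : OnlineAlgorithm.{u, v} U) {α : ℝ}
    (hα : 1 ≤ α) :
    ∃ B : OnlineAlgorithm.{u, v} U, B.IsAlgorithmFor IsMonotoneSubmodularObjective ∧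
      ∀ (E : Finset U) (M : Matroid U), M.E = (E : Set U) →
        ∀ k : ℕ, 1 ≤ k → A.IsUniformAmong E M k α →
        B.CompetitiveOn IsMonotoneSubmodularObjective E M (8 * k * α * (α + 1)) := by
  -- The choice q = 1 makes the label probabilities independent of `k`, so one algorithm serves all
  -- `k`.
  have h0 : 0 ≤ 1 / (2 * (α * 1 + 1)) := by positivity
  have h1 : 1 / (2 * (α * 1 + 1)) ≤ 1 := by
    rw [div_le_one (by positivity)]; linarith
  refine ⟨(A.reduction h0 h1).guarded, isAlgorithmFor_guarded _ _, fun E M hME k hk hA => ?_⟩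
  refine A.competitiveOn_guarded_reduction h0 h1 hME fun f hnonneg hmono hsub O hOE hO => ?_
  have := A.le_expectedValue_guarded_reduction (E := E) (M := M) (κ := 1 / (k : ℝ)) hα
    zero_le_one (by positivity) rfl h0 h1 hnonneg hmono hsub
    (fun t S => A.indep_of_isUniformAmong (isLinearObjective_linearWeight hmono t) hA)
    (fun t I hI δ hδ => A.sum_ge_of_isUniformAmong hk hnonneg hmono hsub hA t hI hδ) hOE hO
  refine le_trans (le_of_eq ?_) this
  rw [one_div_mul_eq_div, div_div]
  congr 1
  ring

end OnlineAlgorithm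

end Competitiveness

theorem theorem4 {U : Type u} (Linear : OnlineAlgorithm.{u, v} U) (α : ℝ) (hα : 1 ≤ α) :
    (∃ A : OnlineAlgorithm.{u, v} U, A.IsAlgorithmFor IsMonotoneSubmodularObjective ∧
      ∀ (E : Finset U) (M : Matroid U), M.E = (E : Set U) →
        Linear.CompetitiveOn IsLinearObjective E M α →
        A.CompetitiveOn IsMonotoneSubmodularObjective E M (8 * α * (α + 1))) ∧
    (∃ A : OnlineAlgorithm.{u, v} U, A.IsAlgorithmFor IsMonotoneSubmodularObjective ∧
      ∀ (E : Finset U) (M : Matroid U), M.E = (E : Set U) →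
        ∀ k : ℕ, 1 ≤ k → Linear.IsUniformAmong E M k α →
        A.CompetitiveOn IsMonotoneSubmodularObjective E M (8 * k * α * (α + 1))) ∧
    (∀ q : ℝ, 0 < q → q ≤ 1 →
      ∃ A : OnlineAlgorithm.{u, v} U, A.IsAlgorithmFor IsMonotoneSubmodularObjective ∧
      ∀ (E : Finset U) (M : Matroid U), M.E = (E : Set U) →
        Linear.CompetitiveOn IsLinearObjective E M α →
        Linear.SelectsWithProbAtMost E M q →
        A.CompetitiveOn IsMonotoneSubmodularObjective E M (8 * α * (α * q + 1))) := by
  refine ⟨?_, Linear.exists_competitive_of_isUniformAmong hα, fun q hq _ =>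
    Linear.exists_competitive_of_selectsWithProbAtMost hα hq.le⟩
  -- Selection probabilities never exceed 1, so the first claim is the case q = 1.
  obtain ⟨A, hA, hcomp⟩ :=
    Linear.exists_competitive_of_selectsWithProbAtMost hα zero_le_one
  refine ⟨A, hA, fun E M hME hlin => ?_⟩
  have := hcomp E M hME hlin fun f _ x _ => Linear.outputProb_le_one E M f _
  rwa [mul_one] at this
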